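/- Let $a_0,a_1,a_2\in\mathbb R$ with $a_2>0$, let $V(x)=a_2x^2+a_1x+a_0$ for $x\in\mathbb R$, and let $H=-\frac{d^2}{dx^2}+V$ be the operator on $L^2(\mathbb R)$ (with real or complex scalars) associated with the form $$\mathfrak a(u,v)=\int_{\mathbb R}\bigl(u'\,\overline{v'}+V\,u\,\overline v\bigr)\,dx,\qquad \operatorname{dom}\mathfrak a=\Bigl\{u\in H^1(\mathbb R):\int_{\mathbb R}|V|\,|u|^2\,dx<\infty\Bigr\};$$ that is, $u\in\operatorname{dom}H$ and $Hu=h\in L^2(\mathbb R)$ if and only if $u\in\operatorname{dom}\mathfrak a$ and $\mathfrak a(u,v)=\int_{\mathbb R} h\,\overline v\,dx$ for all $v\in\operatorname{dom}\mathfrak a$. A real function $p(x,y,t)$, $x,y\in\mathbb R$, $t>0$, measurable in $(x,y)$, is called a heat kernel of $H$ if for every $f\in L^2(\mathbb R)$ the problem $$\partial_tu+Hu=0\quad(t>0),\qquad \lim_{t\to0^+}u(\cdot,t)=f,$$ with the derivative and the limit taken in $L^2(\mathbb R)$ and $u(\cdot,t)\in\operatorname{dom}H$ for $t>0$, has a solution,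 and every solution satisfies, for each $t>0$ and almost every $x$, $$u(x,t)=e^{-tH}f(x)=\int_{\mathbb R}p(x,y,t)f(y)\,dy$$ with an absolutely convergent integral. Then the function \begin{align*} p(x,y,t)={}&\left(\frac{\sqrt{a_2}\,\operatorname{csch}(2\sqrt{a_2}\,t)}{2\pi}\right)^{1/2}e^{\left(\frac{a_1^2}{4a_2}-a_0\right)t}\\ &\cdot\exp\left\{-\frac{a_1^2}{4(\sqrt{a_2})^3}\bigl(\coth(2\sqrt{a_2}\,t)-\operatorname{csch}(2\sqrt{a_2}\,t)\bigr)\right\}\\ &\cdot\exp\left\{-\frac{\sqrt{a_2}}2\Bigl((x-y)^2\operatorname{csch}(2\sqrt{a_2}\,t)+(x^2+y^2)\bigl(\coth(2\sqrt{a_2}\,t)-\operatorname{csch}(2\sqrt{a_2}\,t)\bigr)\Bigr)\right\}\\ &\cdot\exp\left\{-\frac{a_1}{2\sqrt{a_2}}(x+y)\bigl(\coth(2\sqrt{a_2}\,t)-\operatorname{csch}(2\sqrt{a_2}\,t)\bigr)\right\} \end{align*} is a heat kernel of $H$ and is continuous in $(x,y)\in\mathbb R^2$ for each $t>0$. It is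 the only one: every heat kernel of $H$ agrees with it for each $t>0$ at almost every $(x,y)\in\mathbb R^2$, and, for each $t>0$ at which the heat kernel is continuous in $(x,y)$, at all $x,y\in\mathbb R$. -/

import Mathlib

open MeasureTheory Filter Topology
open scoped ContDiff

noncomputable section

namespace Schrodinger

/-- `L²(ℝ)` with respect to Lebesgue measure, with scalars `𝕜 = ℝ` or `ℂ`. -/
abbrev L2 (𝕜 : Type*) [RCLike 𝕜] : Type _ := Lp 𝕜 2 (volume : Measure ℝ)

/-- `u' ∈ L²(ℝ)` is the weak derivative of `u ∈ L²(ℝ)`; thus `u ∈ H¹(ℝ)`. -/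
def HasWeakDeriv {𝕜 : Type*} [RCLike 𝕜] (u u' : L2 𝕜) : Prop :=
  ∀ φ : ℝ → ℝ, ContDiff ℝ ∞ φ → HasCompactSupport φ →
    ∫ x, deriv φ x • u x = -∫ x, φ x • u' x

/-- `u` lies in the domain of the Dirichlet form of `-d²/dx² + V`, that is,
`u ∈ H¹(ℝ)` and `∫ |V| |u|² < ∞`; and `u'` is its weak derivative. -/
structure InFormDomain {𝕜 : Type*} [RCLike 𝕜] (V : ℝ → ℝ) (u u' : L2 𝕜) : Prop where
  weakDeriv : HasWeakDeriv u u'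
  potential : Integrable (fun x => V x * ‖u x‖ ^ 2)

/-- The Dirichlet form `∫ (u' conj(v') + V u conj(v)) dx`; Mathlib's inner product is
conjugate-linear in its first argument. -/
def form {𝕜 : Type*} [RCLike 𝕜] (V : ℝ → ℝ) (u u' v v' : L2 𝕜) : 𝕜 :=
  ∫ x, (inner 𝕜 (v' x) (u' x) + V x • inner 𝕜 (v x) (u x))

/-- The graph of the operator `H = -d²/dx² + V` on `L²(ℝ)` associated with the Dirichlet form:
`u` is in the domain of `H` and `H u = h`. -/
def OperatorGraph {𝕜 : Type*} [RCLike 𝕜] (V : ℝ → ℝ) (u h : L2 𝕜) : Prop :=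
  ∃ u' : L2 𝕜, InFormDomain V u u' ∧
    ∀ v v' : L2 𝕜, InFormDomain V v v' → form V u u' v v' = inner 𝕜 v h

/-- `u` solves `∂ₜ u + H u = 0` on `(0, ∞)` with `u(t) → f` as `t → 0⁺`, where the derivative
and the limit are taken in `L²(ℝ)`. For `H` self-adjoint and bounded below and any `f ∈ L²(ℝ)`
the function `u(t) = e^{-tH} f` is the only such solution. The values `u t` with `t ≤ 0` are
irrelevant. -/
structure IsHeatSolution {𝕜 : Type*} [RCLike 𝕜] (V : ℝ → ℝ) (f : L2 𝕜) (u : ℝ → L2 𝕜) :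
    Prop where
  equation : ∀ t : ℝ, 0 < t → ∃ h : L2 𝕜, OperatorGraph V (u t) h ∧ HasDerivAt u (-h) t
  initial : Tendsto u (𝓝[>] 0) (𝓝 f)

/-- `p(x, y, t)` is a heat kernel of `H = -d²/dx² + V` on `L²(ℝ)`: the heat equation of `H` is
solvable for every initial value `f ∈ L²(ℝ)`, and each solution is given, for every `t > 0` and
almost every `x`, by the convergent integral `∫ p(x, y, t) f(y) dy`. -/
structure IsHeatKernel (𝕜 : Type*) [RCLike 𝕜] (V : ℝ → ℝ) (p : ℝ → ℝ → ℝ → ℝ) : Prop where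
  measurable : ∀ t : ℝ, 0 < t →
    AEStronglyMeasurable (fun z : ℝ × ℝ => p z.1 z.2 t) (volume : Measure (ℝ × ℝ))
  exists_solution : ∀ f : L2 𝕜, ∃ u : ℝ → L2 𝕜, IsHeatSolution V f u
  representation : ∀ (f : L2 𝕜) (u : ℝ → L2 𝕜), IsHeatSolution V f u → ∀ t : ℝ, 0 < t →
    ∀ᵐ x : ℝ, Integrable (fun y => p x y t • f y) ∧ u t x = ∫ y, p x y t • f y

/-- Hyperbolic cosecant. -/
def csch (s : ℝ) : ℝ := 1 / Real.sinh s

/-- Hyperbolic cotangent. -/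
def coth (s : ℝ) : ℝ := Real.cosh s / Real.sinh s

/-- The closed formula for the potential `a₂ x² + a₁ x + a₀`. -/
def quadraticKernel (a₀ a₁ a₂ x y t : ℝ) : ℝ :=
  √(√a₂ * csch (2 * √a₂ * t) / (2 * Real.pi))
    * Real.exp ((a₁ ^ 2 / (4 * a₂) - a₀) * t)
    * Real.exp (-(a₁ ^ 2 / (4 * √a₂ ^ 3)) * (coth (2 * √a₂ * t) - csch (2 * √a₂ * t)))
    * Real.exp (-(√a₂ / 2) * ((x - y) ^ 2 * csch (2 * √a₂ * t)
        + (x ^ 2 + y ^ 2) * (coth (2 * √a₂ * t) - csch (2 * √a₂ * t))))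
    * Real.exp (-(a₁ / (2 * √a₂)) * ((x + y) * (coth (2 * √a₂ * t) - csch (2 * √a₂ * t))))

end Schrodinger

end

/-!
Completing the square turns the potential into `c² (x + b)² + l`, for which Mehler's formula gives
an explicit kernel. It is a Gaussian in both variables, so it and the kernels obtained from it by
differentiating in `t`, twice in `x`, or multiplying by the potential are Hilbert–Schmidt; hence the
integral operator may be differentiated under the integral sign and produces functions in the domain
of `H` which solve the heat equation. Up to factors tending to `1` the kernel is a Gaussian density
of variance `sinh (2 c t) / c → 0`. Schur's test then bounds the operator norm by `e^{-l t}`, and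
together with pointwise convergence on continuous compactly supported functions this gives strong
convergence to the identity: a bound `‖u t‖ ≤ r t → ‖f‖` upgrades weak to strong convergence.

Since `V ≥ l`, the form inequality `Re ⟪u, H u⟫ ≥ l ‖u‖²` makes `e^{2 l t} ‖u t‖²` nonincreasing
along every solution, so a solution is determined by its initial value and any two heat kernels
define the same operators on `L²(ℝ)`. Testing them on indicators of intervals with rational
endpoints shows that they agree almost everywhere.
-/

noncomputable section

namespace Schrodinger

section Hilbert

theorem tendsto_of_tendsto_re_inner {𝕜 E ι : Type*} [RCLike 𝕜] [NormedAddCommGroup E]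
    [InnerProductSpace 𝕜 E] {L : Filter ι} {x : E} {y : ι → E} {r : ι → ℝ}
    (hinner : Tendsto (fun i => RCLike.re (inner 𝕜 x (y i))) L (𝓝 (‖x‖ ^ 2)))
    (hr : Tendsto r L (𝓝 ‖x‖)) (hyr : ∀ᶠ i in L, ‖y i‖ ≤ r i) : Tendsto y L (𝓝 x) := by
  have hlim : Tendsto (fun i => ‖x‖ ^ 2 - 2 * RCLike.re (inner 𝕜 x (y i)) + r i ^ 2) L (𝓝 0) := by
    have := ((hinner.const_mul 2).const_sub (‖x‖ ^ 2)).add (hr.pow 2)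
    rwa [show ‖x‖ ^ 2 - 2 * ‖x‖ ^ 2 + ‖x‖ ^ 2 = 0 by ring] at this
  have hsq : Tendsto (fun i => ‖x - y i‖ ^ 2) L (𝓝 0) := by
    refine squeeze_zero' (.of_forall fun i => sq_nonneg _) ?_ hlim
    filter_upwards [hyr] with i hi
    rw [norm_sub_sq (𝕜 := 𝕜)]
    gcongr
  rw [tendsto_iff_norm_sub_tendsto_zero]
  simpa only [norm_sub_rev, Real.sqrt_sq (norm_nonneg _), Real.sqrt_zero] using hsq.sqrt

theorem tendsto_of_forall_exists_dist_lt {X ι : Type*} [PseudoMetricSpace X] {L : Filter ι}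
    {T : ι → X → X} {B : ℝ} (hT : ∀ᶠ i in L, ∀ x y, dist (T i x) (T i y) ≤ B * dist x y)
    {x : X} (hx : ∀ δ > 0, ∃ y, dist x y < δ ∧ Tendsto (fun i => T i y) L (𝓝 y)) :
    Tendsto (fun i => T i x) L (𝓝 x) := by
  refine Metric.tendsto_nhds.2 fun ε hε => ?_
  obtain ⟨y, hxy, hy⟩ := hx (ε / (2 * (|B| + 1))) (by positivity)
  filter_upwards [hT, Metric.tendsto_nhds.1 hy (ε / 2) (half_pos hε)] with i hTi hyi
  calc dist (T i x) x ≤ dist (T i x) (T i y) + dist (T i y) y + dist y x := dist_triangle4 ..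
    _ ≤ |B| * dist x y + dist (T i y) y + dist x y := by
        rw [dist_comm y x]
        gcongr
        exact (hTi x y).trans (by gcongr; exact le_abs_self B)
    _ < (|B| + 1) * (ε / (2 * (|B| + 1))) + ε / 2 := by
        have := mul_lt_mul_of_pos_left hxy (show 0 < |B| + 1 by positivity)
        linarith
    _ = ε := by field_simp; norm_num

theorem antitoneOn_exp_mul_norm_sq {E : Type*} [NormedAddCommGroup E] [InnerProductSpace ℝ E]
    {u h : ℝ → E} {l : ℝ} (hu : ∀ t > 0, HasDerivAt u (-h t) t)
    (hl : ∀ t > 0, l * ‖u t‖ ^ 2 ≤ inner ℝ (u t) (h t)) :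
    AntitoneOn (fun t => Real.exp (2 * l * t) * ‖u t‖ ^ 2) (Set.Ioi 0) := by
  have hd : ∀ t > 0, HasDerivAt (fun t => Real.exp (2 * l * t) * ‖u t‖ ^ 2)
      (2 * Real.exp (2 * l * t) * (l * ‖u t‖ ^ 2 - inner ℝ (u t) (h t))) t := by
    intro t ht
    have hexp : HasDerivAt (fun t => Real.exp (2 * l * t)) (Real.exp (2 * l * t) * (2 * l)) t := by
      simpa using ((hasDerivAt_id t).const_mul (2 * l)).exp
    refine (hexp.mul (hu t ht).norm_sq).congr_deriv ?_
    rw [inner_neg_right]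
    ring
  refine antitoneOn_of_deriv_nonpos (convex_Ioi 0)
    (fun t ht => (hd t ht).continuousAt.continuousWithinAt) ?_ ?_
  · rw [interior_Ioi]
    exact fun t ht => (hd t ht).differentiableAt.differentiableWithinAt
  · rw [interior_Ioi]
    intro t ht
    rw [(hd t ht).deriv]
    exact mul_nonpos_of_nonneg_of_nonpos (by positivity) (sub_nonpos.2 (hl t ht))

end Hilbert

section L2

variable {α : Type*} [MeasurableSpace α] {μ : Measure α} {𝕜 : Type*} [RCLike 𝕜]

theorem integrable_smul_of_memLp {E : Type*} [NormedAddCommGroup E] [NormedSpace ℝ E]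
    {φ : α → ℝ} {v : α → E} (hφ : MemLp φ 2 μ) (hv : MemLp v 2 μ) :
    Integrable (fun x => φ x • v x) μ :=
  memLp_one_iff_integrable.1 (hv.smul hφ)

theorem integral_smul_coeFn_sub {E : Type*} [NormedAddCommGroup E] [NormedSpace ℝ E]
    {φ : α → ℝ} (hφ : MemLp φ 2 μ) (u v : Lp E 2 μ) :
    ∫ x, φ x • (u - v : Lp E 2 μ) x ∂μ = ∫ x, φ x • u x ∂μ - ∫ x, φ x • v x ∂μ := by
  rw [← integral_sub (integrable_smul_of_memLp hφ (Lp.memLp u))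
    (integrable_smul_of_memLp hφ (Lp.memLp v))]
  refine integral_congr_ae ?_
  filter_upwards [Lp.coeFn_sub u v] with x hx
  rw [hx, Pi.sub_apply, smul_sub]

theorem integrable_norm_sq (u : Lp 𝕜 2 μ) : Integrable (fun x => ‖u x‖ ^ 2) μ :=
  (memLp_two_iff_integrable_sq_norm (Lp.aestronglyMeasurable u)).1 (Lp.memLp u)

theorem norm_sq_eq_integral (u : Lp 𝕜 2 μ) : ‖u‖ ^ 2 = ∫ x, ‖u x‖ ^ 2 ∂μ := by
  rw [← real_inner_self_eq_norm_sq u, L2.inner_def]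
  simp_rw [real_inner_self_eq_norm_sq]

theorem real_inner_eq_re_inner_L2 (u h : Lp 𝕜 2 μ) : inner ℝ u h = RCLike.re (inner 𝕜 u h) := by
  rw [L2.inner_def, L2.inner_def, ← integral_re (L2.integrable_inner u h)]
  rfl

theorem inner_toLp_ofReal {φ : α → ℝ} (hφ : MemLp φ 2 μ) (u : Lp 𝕜 2 μ) :
    inner 𝕜 (MemLp.toLp _ (hφ.ofReal (K := 𝕜))) u = ∫ x, φ x • u x ∂μ := by
  rw [L2.inner_def]
  refine integral_congr_ae ?_
  filter_upwards [(hφ.ofReal (K := 𝕜)).coeFn_toLp] with x hx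
  rw [hx, RCLike.inner_apply, RCLike.conj_ofReal, RCLike.real_smul_eq_coe_mul, mul_comm]

theorem integral_smul_toLp_ofReal (θ : α → ℝ) {φ : α → ℝ} (hφ : MemLp φ 2 μ) :
    ∫ x, θ x • MemLp.toLp _ (hφ.ofReal (K := 𝕜)) x ∂μ = ((∫ x, θ x * φ x ∂μ : ℝ) : 𝕜) := by
  rw [← integral_ofReal]
  refine integral_congr_ae ?_
  filter_upwards [(hφ.ofReal (K := 𝕜)).coeFn_toLp] with x hx
  rw [hx, RCLike.real_smul_eq_coe_mul, RCLike.ofReal_mul]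

end L2

section WeakDerivative

variable {𝕜 : Type*} [RCLike 𝕜]

theorem memLp_deriv_of_contDiff {φ : ℝ → ℝ} (hφ : ContDiff ℝ ∞ φ) (hc : HasCompactSupport φ) :
    MemLp (deriv φ) 2 :=
  (hφ.continuous_deriv (by simp)).memLp_of_hasCompactSupport hc.deriv

theorem HasWeakDeriv.sub {u u' v v' : L2 𝕜} (hu : HasWeakDeriv u u') (hv : HasWeakDeriv v v') :
    HasWeakDeriv (u - v) (u' - v') := by
  intro φ hφ hc
  rw [integral_smul_coeFn_sub (memLp_deriv_of_contDiff hφ hc),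
    integral_smul_coeFn_sub (hφ.continuous.memLp_of_hasCompactSupport hc), hu φ hφ hc, hv φ hφ hc]
  ring

theorem hasWeakDeriv_toLp_ofReal {ψ : ℝ → ℝ} (hψ : Differentiable ℝ ψ) (h₀ : MemLp ψ 2)
    (h₁ : MemLp (deriv ψ) 2) :
    HasWeakDeriv (MemLp.toLp _ (h₀.ofReal (K := 𝕜))) (MemLp.toLp _ (h₁.ofReal (K := 𝕜))) := by
  intro φ hφ hc
  have hφ₀ : MemLp φ 2 := hφ.continuous.memLp_of_hasCompactSupport hc
  have hφ₁ := memLp_deriv_of_contDiff hφ hc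
  rw [integral_smul_toLp_ofReal _ h₀, integral_smul_toLp_ofReal _ h₁, ← RCLike.ofReal_neg,
    integral_mul_deriv_eq_deriv_mul_of_integrable (v := ψ) (u := φ)
      (fun x _ => (hφ.differentiable (by simp) x).hasDerivAt) (fun x _ => (hψ x).hasDerivAt)
      (hφ₀.integrable_mul h₁) (hφ₁.integrable_mul h₀) (hφ₀.integrable_mul h₀), neg_neg]

theorem continuous_integral_comp_mul_smul {E : Type*} [NormedAddCommGroup E] [NormedSpace ℝ E]
    {η : ℝ → ℝ} (hη : Continuous η) {C : ℝ} (hC : ∀ x, ‖η x‖ ≤ C) {w : ℝ → E}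
    (hw : Integrable w) : Continuous fun ε : ℝ => ∫ x, η (ε * x) • w x := by
  refine continuous_of_dominated (bound := fun x => C * ‖w x‖) (fun ε => ?_)
    (fun ε => .of_forall fun x => ?_) (hw.norm.const_mul C) (.of_forall fun x => by fun_prop)
  · exact (by fun_prop : Continuous fun x => η (ε * x)).aestronglyMeasurable.smul
      hw.aestronglyMeasurable
  · rw [norm_smul]
    exact mul_le_mul_of_nonneg_right (hC _) (norm_nonneg _)

theorem integral_eq_zero_of_integral_deriv_smul {E : Type*} [NormedAddCommGroup E]
    [NormedSpace ℝ E] {w w' : ℝ → E} (hw : Integrable w) (hw' : Integrable w')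
    (h : ∀ φ : ℝ → ℝ, ContDiff ℝ ∞ φ → HasCompactSupport φ →
      ∫ x, deriv φ x • w x = -∫ x, φ x • w' x) :
    ∫ x, w' x = 0 := by
  let χ : ContDiffBump (0 : ℝ) := ⟨1, 2, one_pos, one_lt_two⟩
  have hχ : ContDiff ℝ ∞ χ := χ.contDiff
  have hχ' : Continuous (deriv χ) := hχ.continuous_deriv (by simp)
  obtain ⟨C, hC⟩ := χ.continuous.bounded_above_of_compact_support χ.hasCompactSupport
  obtain ⟨C', hC'⟩ := hχ'.bounded_above_of_compact_support χ.hasCompactSupport.deriv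
  have heq : ∀ ε ∈ ({0}ᶜ : Set ℝ),
      ε • ∫ x, deriv χ (ε * x) • w x = -∫ x, χ (ε * x) • w' x := by
    intro ε hε
    rw [← h (fun x => χ (ε * x)) (hχ.comp (contDiff_const.mul contDiff_id))
      (χ.hasCompactSupport.comp_homeomorph (Homeomorph.mulLeft₀ ε hε)), ← integral_smul]
    simp_rw [deriv_comp_mul_left, smul_assoc]
  have hzero := congrFun (Continuous.ext_on (dense_compl_singleton (0 : ℝ))
    (continuous_id.smul (continuous_integral_comp_mul_smul hχ' hC' hw))
    (continuous_integral_comp_mul_smul χ.continuous hC hw').neg heq) 0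
  have hχ0 : χ 0 = 1 := χ.one_of_mem_closedBall (by simp [χ])
  simpa [hχ0] using hzero

theorem HasWeakDeriv.integral_deriv_smul {v v' : L2 𝕜} (hv : HasWeakDeriv v v')
    {ψ : ℝ → ℝ} (hψ : ContDiff ℝ ∞ ψ) (h₀ : MemLp ψ 2) (h₁ : MemLp (deriv ψ) 2) :
    ∫ x, deriv ψ x • v x = -∫ x, ψ x • v' x := by
  have hψv := integrable_smul_of_memLp h₀ (Lp.memLp v)
  have hψ'v := integrable_smul_of_memLp h₁ (Lp.memLp v)
  have hψv' := integrable_smul_of_memLp h₀ (Lp.memLp v')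
  rw [eq_neg_iff_add_eq_zero, ← integral_add hψ'v hψv']
  refine integral_eq_zero_of_integral_deriv_smul hψv (hψ'v.add hψv') fun φ hφ hc => ?_
  have hderiv : ∀ x, deriv (fun x => φ x * ψ x) x = deriv φ x * ψ x + φ x * deriv ψ x := fun x =>
    deriv_mul (hφ.differentiable (by simp) x) (hψ.differentiable (by simp) x)
  obtain ⟨C, hC⟩ := hφ.continuous.bounded_above_of_compact_support hc
  obtain ⟨C', hC'⟩ := (hφ.continuous_deriv (by simp)).bounded_above_of_compact_support hc.deriv
  have hφ_int : ∀ {w : ℝ → 𝕜}, Integrable w → Integrable fun x => φ x • w x := fun hw =>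
    hw.bdd_smul C hφ.continuous.aestronglyMeasurable (.of_forall hC)
  have hφ'_int : Integrable fun x => deriv φ x • ψ x • v x := hψv.bdd_smul C'
    (hφ.continuous_deriv (by simp)).aestronglyMeasurable (.of_forall hC')
  have hprod := hv _ (hφ.mul hψ) hc.mul_right
  simp_rw [hderiv, add_smul, mul_smul] at hprod
  rw [integral_add hφ'_int (hφ_int hψ'v)] at hprod
  simp_rw [smul_add]
  rw [integral_add (hφ_int hψ'v) (hφ_int hψv'), ← neg_eq_iff_eq_neg.2 hprod]
  ring

end WeakDerivative

section HeatEquation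

variable {𝕜 : Type*} [RCLike 𝕜] {V : ℝ → ℝ} {l : ℝ} {u u' v v' f g h k : L2 𝕜}

theorem InFormDomain.integrable_potential_inner (hV : AEStronglyMeasurable V)
    (hu : InFormDomain V u u') (hv : InFormDomain V v v') :
    Integrable (fun x => V x • inner 𝕜 (v x) (u x)) := by
  refine Integrable.mono' (hu.potential.norm.add hv.potential.norm)
    (hV.smul ((Lp.aestronglyMeasurable v).inner (Lp.aestronglyMeasurable u)))
    (.of_forall fun x => ?_)
  have hinner : ‖inner 𝕜 (v x) (u x)‖ ≤ ‖u x‖ ^ 2 + ‖v x‖ ^ 2 := by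
    nlinarith [norm_inner_le_norm (𝕜 := 𝕜) (v x) (u x), two_mul_le_add_sq ‖v x‖ ‖u x‖,
      sq_nonneg ‖u x‖, sq_nonneg ‖v x‖]
  calc ‖V x • inner 𝕜 (v x) (u x)‖ ≤ ‖V x‖ * (‖u x‖ ^ 2 + ‖v x‖ ^ 2) := by
        rw [norm_smul]
        gcongr
    _ = ‖V x * ‖u x‖ ^ 2‖ + ‖V x * ‖v x‖ ^ 2‖ := by
        simp only [norm_mul, norm_pow, norm_norm, mul_add]

theorem InFormDomain.sub (hV : AEStronglyMeasurable V) (hu : InFormDomain V u u')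
    (hv : InFormDomain V v v') : InFormDomain V (u - v) (u' - v') := by
  refine ⟨hu.weakDeriv.sub hv.weakDeriv, ?_⟩
  have hcross := (hu.integrable_potential_inner hV hv).re.const_mul 2
  refine ((hu.potential.sub hcross).add hv.potential).congr ?_
  filter_upwards [Lp.coeFn_sub u v] with x hx
  rw [hx, Pi.sub_apply, norm_sub_sq (𝕜 := 𝕜), inner_re_symm]
  simp only [Pi.add_apply, Pi.sub_apply, RCLike.smul_re]
  ring

theorem InFormDomain.form_eq (hV : AEStronglyMeasurable V) (hu : InFormDomain V u u')
    (hv : InFormDomain V v v') :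
    form V u u' v v' = inner 𝕜 v' u' + ∫ x, V x • inner 𝕜 (v x) (u x) := by
  rw [form, integral_add (L2.integrable_inner v' u') (hu.integrable_potential_inner hV hv),
    L2.inner_def]

theorem InFormDomain.form_sub {w w' : L2 𝕜} (hV : AEStronglyMeasurable V)
    (hu : InFormDomain V u u') (hv : InFormDomain V v v') (hw : InFormDomain V w w') :
    form V (u - v) (u' - v') w w' = form V u u' w w' - form V v v' w w' := by
  have hpot : ∫ x, V x • inner 𝕜 (w x) ((u - v : L2 𝕜) x)
      = (∫ x, V x • inner 𝕜 (w x) (u x)) - ∫ x, V x • inner 𝕜 (w x) (v x) := by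
    rw [← integral_sub (hu.integrable_potential_inner hV hw)
      (hv.integrable_potential_inner hV hw)]
    refine integral_congr_ae ?_
    filter_upwards [Lp.coeFn_sub u v] with x hx
    rw [hx, Pi.sub_apply, inner_sub_right, smul_sub]
  rw [(hu.sub hV hv).form_eq hV hw, hu.form_eq hV hw, hv.form_eq hV hw, hpot, inner_sub_right]
  ring

theorem OperatorGraph.sub (hV : AEStronglyMeasurable V) (hu : OperatorGraph V u h)
    (hv : OperatorGraph V v k) : OperatorGraph V (u - v) (h - k) := by
  obtain ⟨u', hu', hu⟩ := hu
  obtain ⟨v', hv', hv⟩ := hv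
  refine ⟨u' - v', hu'.sub hV hv', fun w w' hw => ?_⟩
  rw [hu'.form_sub hV hv' hw, hu w w' hw, hv w w' hw, inner_sub_right]

theorem OperatorGraph.le_re_inner (hV : AEStronglyMeasurable V) (hl : ∀ᵐ x, l ≤ V x)
    (hu : OperatorGraph V u h) : l * ‖u‖ ^ 2 ≤ RCLike.re (inner 𝕜 u h) := by
  obtain ⟨u', hu', hu⟩ := hu
  have hpot : ∀ x, RCLike.re (V x • inner 𝕜 (u x) (u x)) = V x * ‖u x‖ ^ 2 := fun x => by
    rw [RCLike.smul_re, inner_self_eq_norm_sq]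
  have hlower : ∫ x, l * ‖u x‖ ^ 2 ≤ ∫ x, V x * ‖u x‖ ^ 2 := by
    refine integral_mono_ae ((integrable_norm_sq u).const_mul l) hu'.potential ?_
    filter_upwards [hl] with x hx
    gcongr
  calc l * ‖u‖ ^ 2 = ∫ x, l * ‖u x‖ ^ 2 := by rw [integral_const_mul, norm_sq_eq_integral]
    _ ≤ RCLike.re (inner 𝕜 u' u') + ∫ x, V x * ‖u x‖ ^ 2 := by
        linarith [inner_self_nonneg (𝕜 := 𝕜) (x := u')]
    _ = RCLike.re (inner 𝕜 u h) := by
        rw [← hu u u' hu', hu'.form_eq hV hu', map_add,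
          ← integral_re (hu'.integrable_potential_inner hV hu')]
        simp_rw [hpot]

theorem IsHeatSolution.sub (hV : AEStronglyMeasurable V) {u v : ℝ → L2 𝕜}
    (hu : IsHeatSolution V f u) (hv : IsHeatSolution V g v) :
    IsHeatSolution V (f - g) (fun t => u t - v t) where
  equation t ht := by
    obtain ⟨h, hgu, hdu⟩ := hu.equation t ht
    obtain ⟨k, hgv, hdv⟩ := hv.equation t ht
    exact ⟨h - k, hgu.sub hV hgv, (hdu.sub hdv).congr_deriv (by abel)⟩
  initial := hu.initial.sub hv.initial

theorem IsHeatSolution.eq_zero (hV : AEStronglyMeasurable V) (hl : ∀ᵐ x, l ≤ V x)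
    {u : ℝ → L2 𝕜} (hu : IsHeatSolution V 0 u) {t : ℝ} (ht : 0 < t) : u t = 0 := by
  choose! h hgraph hderiv using hu.equation
  have hanti := antitoneOn_exp_mul_norm_sq hderiv (l := l) fun t ht => by
    rw [real_inner_eq_re_inner_L2]
    exact (hgraph t ht).le_re_inner hV hl
  have hlim : Tendsto (fun s => Real.exp (2 * l * s) * ‖u s‖ ^ 2) (𝓝[>] 0) (𝓝 0) := by
    have hexp : Tendsto (fun s => Real.exp (2 * l * s)) (𝓝[>] 0) (𝓝 (Real.exp (2 * l * 0))) :=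
      (by fun_prop : Continuous fun s => Real.exp (2 * l * s)).continuousWithinAt
    simpa using hexp.mul (hu.initial.norm.pow 2)
  have hle : Real.exp (2 * l * t) * ‖u t‖ ^ 2 ≤ 0 := by
    refine ge_of_tendsto hlim ?_
    filter_upwards [Ioo_mem_nhdsGT ht] with s hs using hanti hs.1 ht hs.2.le
  simpa [Real.exp_ne_zero] using hle.antisymm (by positivity)

theorem IsHeatSolution.unique (hV : AEStronglyMeasurable V) (hl : ∀ᵐ x, l ≤ V x)
    {u v : ℝ → L2 𝕜} (hu : IsHeatSolution V f u) (hv : IsHeatSolution V f v)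
    {t : ℝ} (ht : 0 < t) : u t = v t := by
  have hsub := hu.sub hV hv
  rw [sub_self] at hsub
  exact sub_eq_zero.1 (hsub.eq_zero hV hl ht)

end HeatEquation

section HilbertSchmidt

variable {α : Type*} [MeasurableSpace α] {μ : Measure α} {𝕜 : Type*} [RCLike 𝕜]

/-- `K` is a Hilbert–Schmidt kernel: it is square-integrable in both variables jointly. -/
abbrev IsHilbertSchmidt (K : α → α → ℝ) (μ : Measure α) : Prop :=
  MemLp (Function.uncurry K) 2 (μ.prod μ)

open Classical in
/-- The operator `f ↦ ∫ K(·, y) f(y) dy` on `L²`; its value is `0` where this integral is not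
square-integrable, which does not happen for Hilbert–Schmidt kernels. -/
def integralOp (K : α → α → ℝ) (f : Lp 𝕜 2 μ) : Lp 𝕜 2 μ :=
  if h : MemLp (fun x => ∫ y, K x y • f y ∂μ) 2 μ then h.toLp else 0

variable {K K' : α → α → ℝ}

theorem IsHilbertSchmidt.sub (hK : IsHilbertSchmidt K μ) (hK' : IsHilbertSchmidt K' μ) :
    IsHilbertSchmidt (fun x y => K x y - K' x y) μ :=
  MemLp.sub hK hK'

theorem IsHilbertSchmidt.const_mul (hK : IsHilbertSchmidt K μ) (c : ℝ) :
    IsHilbertSchmidt (fun x y => c * K x y) μ :=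
  MemLp.const_mul hK c

theorem memLp_two_mul_prod [SFinite μ] {E F : Type*} [NormedAddCommGroup E] [NormedAddCommGroup F]
    {f : α → E} {g : α → F} (hf : MemLp f 2 μ) (hg : MemLp g 2 μ) :
    MemLp (fun z : α × α => ‖f z.1‖ * ‖g z.2‖) 2 (μ.prod μ) := by
  have hmeas := hf.aestronglyMeasurable.norm.comp_fst (ν := μ) |>.mul
    (hg.aestronglyMeasurable.norm.comp_snd (μ := μ))
  refine (memLp_two_iff_integrable_sq hmeas).2 ?_
  simpa only [Pi.mul_apply, mul_pow] using hf.norm.integrable_sq.mul_prod hg.norm.integrable_sq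

variable [SFinite μ]

namespace IsHilbertSchmidt

theorem swap (hK : IsHilbertSchmidt K μ) : IsHilbertSchmidt (flip K) μ :=
  hK.comp_measurePreserving Measure.measurePreserving_swap

theorem ae_memLp (hK : IsHilbertSchmidt K μ) : ∀ᵐ x ∂μ, MemLp (K x) 2 μ := by
  filter_upwards [hK.aestronglyMeasurable.prodMk_left, hK.integrable_sq.prod_right_ae] with x hx hsq
  exact (memLp_two_iff_integrable_sq hx).2 hsq

theorem ae_integrable_smul (hK : IsHilbertSchmidt K μ) (f : Lp 𝕜 2 μ) :
    ∀ᵐ x ∂μ, Integrable (fun y => K x y • f y) μ := by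
  filter_upwards [hK.ae_memLp] with x hx using integrable_smul_of_memLp hx (Lp.memLp f)

theorem ae_norm_integral_smul_sq_le (hK : IsHilbertSchmidt K μ) (f : Lp 𝕜 2 μ) :
    ∀ᵐ x ∂μ, ‖∫ y, K x y • f y ∂μ‖ ^ 2 ≤ (∫ y, K x y ^ 2 ∂μ) * ‖f‖ ^ 2 := by
  filter_upwards [hK.ae_memLp] with x hx
  have hnorm : ‖MemLp.toLp _ (hx.ofReal (K := 𝕜))‖ ^ 2 = ∫ y, K x y ^ 2 ∂μ := by
    rw [norm_sq_eq_integral]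
    refine integral_congr_ae ?_
    filter_upwards [(hx.ofReal (K := 𝕜)).coeFn_toLp] with y hy
    rw [hy, RCLike.norm_ofReal, sq_abs]
  rw [← inner_toLp_ofReal hx, ← hnorm, ← mul_pow]
  gcongr
  exact norm_inner_le_norm _ _

theorem memLp_integral_smul (hK : IsHilbertSchmidt K μ) (f : Lp 𝕜 2 μ) :
    MemLp (fun x => ∫ y, K x y • f y ∂μ) 2 μ := by
  have hmeas : AEStronglyMeasurable (fun x => ∫ y, K x y • f y ∂μ) μ :=
    (hK.aestronglyMeasurable.smul (Lp.aestronglyMeasurable f).comp_snd).integral_prod_right'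
  refine (memLp_two_iff_integrable_sq_norm hmeas).2 ?_
  refine (hK.integrable_sq.integral_prod_left.mul_const (‖f‖ ^ 2)).mono' (hmeas.norm.pow 2) ?_
  filter_upwards [hK.ae_norm_integral_smul_sq_le f] with x hx
  rwa [norm_pow, norm_norm]

theorem coeFn_integralOp (hK : IsHilbertSchmidt K μ) (f : Lp 𝕜 2 μ) :
    ∀ᵐ x ∂μ, integralOp K f x = ∫ y, K x y • f y ∂μ := by
  rw [integralOp, dif_pos (hK.memLp_integral_smul f)]
  exact (hK.memLp_integral_smul f).coeFn_toLp

theorem norm_integralOp_sq_le (hK : IsHilbertSchmidt K μ) (f : Lp 𝕜 2 μ) :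
    ‖integralOp K f‖ ^ 2 ≤ (∫ z, K z.1 z.2 ^ 2 ∂μ.prod μ) * ‖f‖ ^ 2 := by
  have hprod : ∫ z, K z.1 z.2 ^ 2 ∂μ.prod μ = ∫ x, ∫ y, K x y ^ 2 ∂μ ∂μ :=
    integral_prod _ hK.integrable_sq
  rw [norm_sq_eq_integral, hprod, ← integral_mul_const]
  refine integral_mono_ae (integrable_norm_sq _)
    (hK.integrable_sq.integral_prod_left.mul_const _) ?_
  filter_upwards [hK.coeFn_integralOp f, hK.ae_norm_integral_smul_sq_le f] with x hx hle
  rwa [hx]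

theorem integralOp_sub_kernel (hK : IsHilbertSchmidt K μ) (hK' : IsHilbertSchmidt K' μ)
    (f : Lp 𝕜 2 μ) :
    integralOp (fun x y => K x y - K' x y) f = integralOp K f - integralOp K' f := by
  refine Lp.ext ?_
  filter_upwards [(hK.sub hK').coeFn_integralOp f, hK.coeFn_integralOp f, hK'.coeFn_integralOp f,
    hK.ae_integrable_smul f, hK'.ae_integrable_smul f,
    Lp.coeFn_sub (integralOp K f) (integralOp K' f)] with x hs h h' hi hi' hsub
  rw [hsub, Pi.sub_apply, hs, h, h', ← integral_sub hi hi']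
  simp_rw [sub_smul]

theorem integralOp_const_mul_kernel (hK : IsHilbertSchmidt K μ) (c : ℝ) (f : Lp 𝕜 2 μ) :
    integralOp (fun x y => c * K x y) f = c • integralOp K f := by
  refine Lp.ext ?_
  filter_upwards [(hK.const_mul c).coeFn_integralOp f, hK.coeFn_integralOp f,
    Lp.coeFn_smul c (integralOp K f)] with x hc h hsmul
  rw [hsmul, Pi.smul_apply, hc, h, ← integral_smul]
  simp_rw [mul_smul]

theorem integralOp_sub (hK : IsHilbertSchmidt K μ) (f g : Lp 𝕜 2 μ) :
    integralOp K (f - g) = integralOp K f - integralOp K g := by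
  refine Lp.ext ?_
  filter_upwards [hK.ae_memLp, hK.coeFn_integralOp (f - g), hK.coeFn_integralOp f,
    hK.coeFn_integralOp g, Lp.coeFn_sub (integralOp K f) (integralOp K g)] with x hx hs hf hg hsub
  rw [hsub, Pi.sub_apply, hs, hf, hg, integral_smul_coeFn_sub hx]

theorem inner_integralOp (hK : IsHilbertSchmidt K μ) (v f : Lp 𝕜 2 μ) :
    inner 𝕜 v (integralOp K f) = inner 𝕜 (integralOp (flip K) v) f := by
  have hint : Integrable (fun z : α × α => K z.1 z.2 • inner 𝕜 (v z.1) (f z.2)) (μ.prod μ) := by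
    refine (hK.norm.integrable_mul (memLp_two_mul_prod (Lp.memLp v) (Lp.memLp f))).mono'
      (hK.aestronglyMeasurable.smul
        ((Lp.aestronglyMeasurable v).comp_fst.inner (Lp.aestronglyMeasurable f).comp_snd))
      (.of_forall fun z => ?_)
    rw [norm_smul]
    exact mul_le_mul_of_nonneg_left (norm_inner_le_norm _ _) (norm_nonneg _)
  calc inner 𝕜 v (integralOp K f) = ∫ x, ∫ y, K x y • inner 𝕜 (v x) (f y) ∂μ ∂μ := by
        rw [L2.inner_def]
        refine integral_congr_ae ?_
        filter_upwards [hK.coeFn_integralOp f, hK.ae_integrable_smul f] with x hx hi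
        rw [hx, ← integral_inner hi]
        simp_rw [inner_smul_right_eq_smul]
    _ = ∫ y, ∫ x, K x y • inner 𝕜 (v x) (f y) ∂μ ∂μ := integral_integral_swap hint
    _ = inner 𝕜 (integralOp (flip K) v) f := by
        rw [L2.inner_def]
        refine integral_congr_ae ?_
        filter_upwards [hK.swap.coeFn_integralOp v, hK.swap.ae_integrable_smul v] with y hy hi
        rw [hy, ← inner_conj_symm, ← integral_inner hi, ← integral_conj]
        refine integral_congr_ae (.of_forall fun x => ?_)
        simp only [flip, inner_smul_right_eq_smul, RCLike.conj_smul, inner_conj_symm]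

end IsHilbertSchmidt

theorem tendsto_integralOp {ι : Type*} {L : Filter ι} [L.IsCountablyGenerated]
    {k : ι → α → α → ℝ} {G : α × α → ℝ} (hG : MemLp G 2 (μ.prod μ)) (hK : IsHilbertSchmidt K μ)
    (hk : ∀ᶠ i in L, IsHilbertSchmidt (k i) μ)
    (hkG : ∀ᶠ i in L, ∀ᵐ z ∂μ.prod μ, ‖k i z.1 z.2‖ ≤ G z)
    (hlim : ∀ᵐ z ∂μ.prod μ, Tendsto (fun i => k i z.1 z.2) L (𝓝 (K z.1 z.2))) (f : Lp 𝕜 2 μ) :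
    Tendsto (fun i => integralOp (k i) f) L (𝓝 (integralOp K f)) := by
  have hHS : Tendsto (fun i => ∫ z, (k i z.1 z.2 - K z.1 z.2) ^ 2 ∂μ.prod μ) L (𝓝 0) := by
    rw [← integral_zero (α × α) ℝ]
    refine tendsto_integral_filter_of_dominated_convergence (fun z => (G z + ‖K z.1 z.2‖) ^ 2)
      ?_ ?_ (hG.add hK.norm).integrable_sq ?_
    · filter_upwards [hk] with i hi using (hi.sub hK).aestronglyMeasurable.pow 2
    · filter_upwards [hkG] with i hi
      filter_upwards [hi] with z hz
      rw [norm_pow]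
      gcongr
      exact (norm_sub_le _ _).trans (by gcongr)
    · filter_upwards [hlim] with z hz
      simpa using (hz.sub_const (K z.1 z.2)).pow 2
  have hsq : Tendsto (fun i => ‖integralOp (k i) f - integralOp K f‖ ^ 2) L (𝓝 0) := by
    refine squeeze_zero' (.of_forall fun i => sq_nonneg _) ?_
      (by simpa using hHS.mul_const (‖f‖ ^ 2))
    filter_upwards [hk] with i hi
    rw [← hi.integralOp_sub_kernel hK]
    exact (hi.sub hK).norm_integralOp_sq_le f
  rw [tendsto_iff_norm_sub_tendsto_zero]
  simpa only [Real.sqrt_sq (norm_nonneg _), Real.sqrt_zero] using hsq.sqrt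

theorem hasDerivAt_integralOp {k k' : ℝ → α → α → ℝ} {G : α × α → ℝ} {a b t : ℝ}
    (ht : t ∈ Set.Ioo a b) (hG : MemLp G 2 (μ.prod μ))
    (hk : ∀ s ∈ Set.Ioo a b, IsHilbertSchmidt (k s) μ) (hk' : IsHilbertSchmidt (k' t) μ)
    (hderiv : ∀ s ∈ Set.Ioo a b, ∀ x y, HasDerivAt (fun s => k s x y) (k' s x y) s)
    (hbound : ∀ s ∈ Set.Ioo a b, ∀ x y, ‖k' s x y‖ ≤ G (x, y)) (f : Lp 𝕜 2 μ) :
    HasDerivAt (fun s => integralOp (k s) f) (integralOp (k' t) f) t := by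
  have hmem : ∀ᶠ s in 𝓝[≠] t, s ∈ Set.Ioo a b :=
    nhdsWithin_le_nhds (Ioo_mem_nhds ht.1 ht.2)
  have hslope : ∀ᶠ s in 𝓝[≠] t, integralOp (fun x y => (s - t)⁻¹ * (k s x y - k t x y)) f
      = slope (fun s => integralOp (k s) f) t s := by
    filter_upwards [hmem] with s hs
    rw [((hk s hs).sub (hk t ht)).integralOp_const_mul_kernel,
      (hk s hs).integralOp_sub_kernel (hk t ht), slope_def_module]
  rw [hasDerivAt_iff_tendsto_slope]
  refine (tendsto_integralOp hG hk' ?_ ?_ (.of_forall fun z => ?_) f).congr' hslope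
  · filter_upwards [hmem] with s hs using ((hk s hs).sub (hk t ht)).const_mul _
  · filter_upwards [hmem] with s hs
    refine .of_forall fun z => ?_
    have hmvt := (convex_Ioo a b).norm_image_sub_le_of_norm_hasDerivWithin_le
      (fun r hr => (hderiv r hr z.1 z.2).hasDerivWithinAt) (fun r hr => hbound r hr z.1 z.2) ht hs
    rw [norm_mul, norm_inv]
    exact inv_mul_le_of_le_mul₀ (norm_nonneg _) ((norm_nonneg _).trans (hbound t ht _ _))
      (by rwa [mul_comm])
  · simpa only [slope_fun_def, vsub_eq_sub, smul_eq_mul] using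
      hasDerivAt_iff_tendsto_slope.1 (hderiv t ht z.1 z.2)

end HilbertSchmidt

section Differentiation

variable {𝕜 : Type*} [RCLike 𝕜] {K K₁ K₂ : ℝ → ℝ → ℝ}

theorem IsHilbertSchmidt.inner_weakDeriv_integralOp (hK : IsHilbertSchmidt K volume)
    (hK₁ : IsHilbertSchmidt K₁ volume) (hsmooth : ∀ y, ContDiff ℝ ∞ fun x => K x y)
    (hderiv : ∀ y x, HasDerivAt (fun x => K x y) (K₁ x y) x) {v v' : L2 𝕜}
    (hv : HasWeakDeriv v v') (f : L2 𝕜) :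
    inner 𝕜 v' (integralOp K f) = -inner 𝕜 v (integralOp K₁ f) := by
  have hflip : integralOp (flip K) v' = -integralOp (flip K₁) v := by
    refine Lp.ext ?_
    filter_upwards [hK.swap.coeFn_integralOp v', hK₁.swap.coeFn_integralOp v, hK.swap.ae_memLp,
      hK₁.swap.ae_memLp, Lp.coeFn_neg (integralOp (flip K₁) v)] with y h h₁ hy hy₁ hneg
    have hd : deriv (fun x => K x y) = flip K₁ y := funext fun x => (hderiv y x).deriv
    rw [hneg, Pi.neg_apply, h, h₁, ← hd, eq_neg_iff_add_eq_zero, add_comm,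
      hv.integral_deriv_smul (hsmooth y) hy (hd ▸ hy₁)]
    exact neg_add_cancel _
  rw [hK.inner_integralOp, hK₁.inner_integralOp, hflip, inner_neg_left]

theorem IsHilbertSchmidt.hasWeakDeriv_integralOp (hK : IsHilbertSchmidt K volume)
    (hK₁ : IsHilbertSchmidt K₁ volume) (hsmooth : ∀ y, ContDiff ℝ ∞ fun x => K x y)
    (hderiv : ∀ y x, HasDerivAt (fun x => K x y) (K₁ x y) x) (f : L2 𝕜) :
    HasWeakDeriv (integralOp K f) (integralOp K₁ f) := by
  intro φ hφ hc
  have hφ₀ : MemLp φ 2 := hφ.continuous.memLp_of_hasCompactSupport hc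
  have hφ₁ := memLp_deriv_of_contDiff hφ hc
  rw [← inner_toLp_ofReal hφ₀, ← inner_toLp_ofReal hφ₁]
  exact hK.inner_weakDeriv_integralOp hK₁ hsmooth hderiv
    (hasWeakDeriv_toLp_ofReal (hφ.differentiable (by simp)) hφ₀ hφ₁) f

theorem IsHilbertSchmidt.operatorGraph {V : ℝ → ℝ} (hV : AEStronglyMeasurable V)
    (hK : IsHilbertSchmidt K volume) (hK₁ : IsHilbertSchmidt K₁ volume)
    (hK₂ : IsHilbertSchmidt K₂ volume) (hVK : IsHilbertSchmidt (fun x y => V x * K x y) volume)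
    (hsmooth : ∀ y, ContDiff ℝ ∞ fun x => K x y) (hsmooth₁ : ∀ y, ContDiff ℝ ∞ fun x => K₁ x y)
    (hderiv : ∀ y x, HasDerivAt (fun x => K x y) (K₁ x y) x)
    (hderiv₁ : ∀ y x, HasDerivAt (fun x => K₁ x y) (K₂ x y) x) (f : L2 𝕜) :
    OperatorGraph V (integralOp K f) (-integralOp (fun x y => K₂ x y - V x * K x y) f) := by
  have hmul : ∀ᵐ x, integralOp (fun x y => V x * K x y) f x = V x • integralOp K f x := by
    filter_upwards [hK.coeFn_integralOp f, hVK.coeFn_integralOp f] with x h hVx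
    rw [h, hVx, ← integral_smul]
    simp_rw [mul_smul]
  have hdom : InFormDomain V (integralOp K f) (integralOp K₁ f) := by
    refine ⟨hK.hasWeakDeriv_integralOp hK₁ hsmooth hderiv f, ?_⟩
    refine (L2.integrable_inner (𝕜 := 𝕜) (integralOp K f)
      (integralOp (fun x y => V x * K x y) f)).re.congr ?_
    filter_upwards [hmul] with x hx
    rw [hx, inner_smul_right_eq_smul, RCLike.smul_re, inner_self_eq_norm_sq]
  refine ⟨_, hdom, fun v v' hv => ?_⟩
  have hpot : ∫ x, V x • inner 𝕜 (v x) (integralOp K f x)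
      = inner 𝕜 v (integralOp (fun x y => V x * K x y) f) := by
    rw [L2.inner_def]
    refine integral_congr_ae ?_
    filter_upwards [hmul] with x hx
    rw [hx, inner_smul_right_eq_smul]
  rw [hdom.form_eq hV hv, hpot, hK₂.integralOp_sub_kernel hVK, inner_neg_right, inner_sub_right,
    hK₁.inner_weakDeriv_integralOp hK₂ hsmooth₁ hderiv₁ hv.weakDeriv]
  ring

end Differentiation

section SchurTest

open scoped NNReal ENNReal

variable {α : Type*} [MeasurableSpace α] {μ : Measure α} {𝕜 : Type*} [RCLike 𝕜]

/-- The hypothesis of the Schur test: every row and every column of the kernel `K` has `L¹` norm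
at most `M`. The norm of `integralOp K` is then at most `M`. -/
structure IsSchurBounded (K : α → α → ℝ) (μ : Measure α) (M : ℝ≥0) : Prop where
  row : ∀ x, ∫⁻ y, ‖K x y‖ₑ ∂μ ≤ M
  column : ∀ y, ∫⁻ x, ‖K x y‖ₑ ∂μ ≤ M

theorem enorm_sq_eq_lintegral (f : Lp 𝕜 2 μ) : ‖f‖ₑ ^ 2 = ∫⁻ x, ‖f x‖ₑ ^ 2 ∂μ := by
  have h := eLpNorm_nnreal_pow_eq_lintegral (f := f) (μ := μ) (p := 2) two_ne_zero
  simp only [NNReal.coe_ofNat, ENNReal.coe_ofNat, ENNReal.rpow_ofNat] at h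
  rw [Lp.enorm_def, h]

theorem sq_lintegral_mul_le {k g : α → ℝ≥0∞} (hk : AEMeasurable k μ) (hg : AEMeasurable g μ) :
    (∫⁻ x, k x * g x ∂μ) ^ 2 ≤ (∫⁻ x, k x ∂μ) * ∫⁻ x, k x * g x ^ 2 ∂μ := by
  have hsplit : ∀ a b : ℝ≥0∞, a ^ (1 / 2 : ℝ) * (a * b ^ 2) ^ (1 / 2 : ℝ) = a * b := fun a b => by
    rw [ENNReal.mul_rpow_of_nonneg _ _ (by norm_num), ← mul_assoc,
      ← ENNReal.rpow_add_of_nonneg _ _ (by norm_num) (by norm_num), ← ENNReal.rpow_natCast_mul]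
    norm_num
  have hCS := ENNReal.lintegral_mul_norm_pow_le (p := 1 / 2) (q := 1 / 2) hk
    (hk.mul (hg.pow_const 2)) (by norm_num) (by norm_num) (by norm_num)
  simp only [Pi.mul_apply, hsplit] at hCS
  refine (pow_le_pow_left' hCS 2).trans_eq ?_
  rw [mul_pow, ← ENNReal.rpow_mul_natCast, ← ENNReal.rpow_mul_natCast]
  norm_num

namespace IsSchurBounded

variable {K : α → α → ℝ} {M : ℝ≥0}

theorem norm_integral_smul_le (hS : IsSchurBounded K μ M) {φ : α → 𝕜} {B : ℝ≥0}
    (hB : ∀ᵐ y ∂μ, ‖φ y‖ ≤ B) (x : α) : ‖∫ y, K x y • φ y ∂μ‖ ≤ M * B := by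
  rw [← ENNReal.ofReal_le_ofReal_iff (by positivity), ofReal_norm]
  calc ‖∫ y, K x y • φ y ∂μ‖ₑ ≤ ∫⁻ y, ‖K x y • φ y‖ₑ ∂μ := enorm_integral_le_lintegral_enorm _
    _ ≤ ∫⁻ y, ‖K x y‖ₑ * B ∂μ := by
        refine lintegral_mono_ae ?_
        filter_upwards [hB] with y hy
        rw [enorm_smul]
        gcongr
        exact enorm_le_coe.2 hy
    _ = (∫⁻ y, ‖K x y‖ₑ ∂μ) * B := lintegral_mul_const' _ _ ENNReal.coe_ne_top
    _ ≤ M * B := by gcongr; exact hS.row x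
    _ = ENNReal.ofReal (M * B) := by
        rw [← ENNReal.coe_mul, ← NNReal.coe_mul, ENNReal.ofReal_coe_nnreal]

variable [SFinite μ]

theorem norm_integralOp_le (hS : IsSchurBounded K μ M) (hK : IsHilbertSchmidt K μ)
    (f : Lp 𝕜 2 μ) : ‖integralOp K f‖ ≤ M * ‖f‖ := by
  have hKm : AEMeasurable (fun z : α × α => ‖K z.1 z.2‖ₑ) (μ.prod μ) :=
    hK.aestronglyMeasurable.enorm
  have hfm : AEMeasurable (fun y => ‖f y‖ₑ) μ := (Lp.aestronglyMeasurable f).enorm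
  have hrow : ∀ᵐ x ∂μ, ‖integralOp K f x‖ₑ ^ 2 ≤ M * ∫⁻ y, ‖K x y‖ₑ * ‖f y‖ₑ ^ 2 ∂μ := by
    filter_upwards [hK.coeFn_integralOp f, hK.ae_memLp] with x hx hKx
    calc ‖integralOp K f x‖ₑ ^ 2 ≤ (∫⁻ y, ‖K x y‖ₑ * ‖f y‖ₑ ∂μ) ^ 2 := by
          rw [hx]
          simpa only [enorm_smul] using
            pow_le_pow_left' (enorm_integral_le_lintegral_enorm fun y => K x y • f y) 2
      _ ≤ (∫⁻ y, ‖K x y‖ₑ ∂μ) * ∫⁻ y, ‖K x y‖ₑ * ‖f y‖ₑ ^ 2 ∂μ :=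
          sq_lintegral_mul_le hKx.aestronglyMeasurable.enorm hfm
      _ ≤ M * ∫⁻ y, ‖K x y‖ₑ * ‖f y‖ₑ ^ 2 ∂μ := by gcongr; exact hS.row x
  have hsq : ‖integralOp K f‖ₑ ^ 2 ≤ (M * ‖f‖ₑ) ^ 2 := by
    rw [enorm_sq_eq_lintegral]
    calc ∫⁻ x, ‖integralOp K f x‖ₑ ^ 2 ∂μ
        ≤ ∫⁻ x, M * ∫⁻ y, ‖K x y‖ₑ * ‖f y‖ₑ ^ 2 ∂μ ∂μ := lintegral_mono_ae hrow
      _ = M * ∫⁻ y, ∫⁻ x, ‖K x y‖ₑ * ‖f y‖ₑ ^ 2 ∂μ ∂μ := by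
          rw [lintegral_const_mul' _ _ ENNReal.coe_ne_top,
            lintegral_lintegral_swap (hKm.mul (hfm.pow_const 2).comp_snd)]
      _ ≤ M * ∫⁻ y, M * ‖f y‖ₑ ^ 2 ∂μ := by
          gcongr with y
          rw [lintegral_mul_const' _ _ (by finiteness)]
          gcongr
          exact hS.column y
      _ = (M * ‖f‖ₑ) ^ 2 := by
          rw [lintegral_const_mul' _ _ ENNReal.coe_ne_top, ← enorm_sq_eq_lintegral]
          ring
  have h := (ENNReal.pow_le_pow_left_iff two_ne_zero).1 hsq
  simpa using ENNReal.toReal_mono (by finiteness) h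

end IsSchurBounded

variable [SFinite μ] {ι : Type*} {L : Filter ι} [L.IsCountablyGenerated] {k : ι → α → α → ℝ}
  {M : ι → ℝ≥0}

theorem tendsto_inner_integralOp_self (hk : ∀ᶠ i in L, IsHilbertSchmidt (k i) μ)
    (hS : ∀ᶠ i in L, IsSchurBounded (k i) μ (M i)) (hM : ∀ᶠ i in L, M i ≤ 2) {φ : Lp 𝕜 2 μ}
    {B : ℝ≥0} (hφ : Integrable φ μ) (hB : ∀ᵐ x ∂μ, ‖φ x‖ ≤ B)
    (hlim : ∀ᵐ x ∂μ, Tendsto (fun i => ∫ y, k i x y • φ y ∂μ) L (𝓝 (φ x))) :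
    Tendsto (fun i => inner 𝕜 φ (integralOp (k i) φ)) L (𝓝 (inner 𝕜 φ φ)) := by
  have hcongr : ∀ᶠ i in L,
      ∫ x, inner 𝕜 (φ x) (∫ y, k i x y • φ y ∂μ) ∂μ = inner 𝕜 φ (integralOp (k i) φ) := by
    filter_upwards [hk] with i hi
    rw [L2.inner_def]
    refine integral_congr_ae ?_
    filter_upwards [hi.coeFn_integralOp φ] with x hx
    rw [hx]
  rw [L2.inner_def φ φ]
  refine Tendsto.congr' hcongr (tendsto_integral_filter_of_dominated_convergence
    (fun x => ‖φ x‖ * (2 * B)) ?_ ?_ (hφ.norm.mul_const _) ?_)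
  · filter_upwards [hk] with i hi
    exact hφ.aestronglyMeasurable.inner (hi.memLp_integral_smul φ).aestronglyMeasurable
  · filter_upwards [hS, hM] with i hSi hMi
    refine .of_forall fun x => (norm_inner_le_norm _ _).trans ?_
    gcongr
    exact (hSi.norm_integral_smul_le hB x).trans (by gcongr; exact hMi)
  · filter_upwards [hlim] with x hx using tendsto_const_nhds.inner hx

theorem tendsto_integralOp_self (hk : ∀ᶠ i in L, IsHilbertSchmidt (k i) μ)
    (hS : ∀ᶠ i in L, IsSchurBounded (k i) μ (M i)) (hM : Tendsto M L (𝓝 1)) {φ : Lp 𝕜 2 μ}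
    {B : ℝ≥0} (hφ : Integrable φ μ) (hB : ∀ᵐ x ∂μ, ‖φ x‖ ≤ B)
    (hlim : ∀ᵐ x ∂μ, Tendsto (fun i => ∫ y, k i x y • φ y ∂μ) L (𝓝 (φ x))) :
    Tendsto (fun i => integralOp (k i) φ) L (𝓝 φ) := by
  have hinner := tendsto_inner_integralOp_self hk hS (hM.eventually_le_const one_lt_two) hφ hB hlim
  refine tendsto_of_tendsto_re_inner (𝕜 := 𝕜) (r := fun i => M i * ‖φ‖) ?_ ?_ ?_
  · rw [← inner_self_eq_norm_sq (𝕜 := 𝕜)]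
    exact (RCLike.continuous_re.tendsto _).comp hinner
  · simpa using (NNReal.tendsto_coe.2 hM).mul_const ‖φ‖
  · filter_upwards [hk, hS] with i hi hSi using hSi.norm_integralOp_le hi φ

theorem tendsto_integralOp_of_continuous [TopologicalSpace α] [BorelSpace α] [NormalSpace α]
    [R1Space α] [WeaklyLocallyCompactSpace α] [μ.Regular] (hk : ∀ᶠ i in L, IsHilbertSchmidt (k i) μ)
    (hS : ∀ᶠ i in L, IsSchurBounded (k i) μ (M i)) (hM : Tendsto M L (𝓝 1))
    (hlim : ∀ φ : α → 𝕜, Continuous φ → HasCompactSupport φ →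
      ∀ x, Tendsto (fun i => ∫ y, k i x y • φ y ∂μ) L (𝓝 (φ x))) (f : Lp 𝕜 2 μ) :
    Tendsto (fun i => integralOp (k i) f) L (𝓝 f) := by
  refine tendsto_of_forall_exists_dist_lt (B := 2) ?_ fun δ hδ => ?_
  · filter_upwards [hk, hS, hM.eventually_le_const one_lt_two] with i hi hSi hMi g h
    rw [dist_eq_norm, dist_eq_norm, ← hi.integralOp_sub]
    refine (hSi.norm_integralOp_le hi _).trans ?_
    gcongr
    exact hMi
  obtain ⟨φ, hsupp, hle, hcont, hmem⟩ := (Lp.memLp f).exists_hasCompactSupport_eLpNorm_sub_le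
    ENNReal.ofNat_ne_top (ε := ENNReal.ofReal (δ / 2)) (by simpa using hδ)
  obtain ⟨B, hB⟩ := hcont.bounded_above_of_compact_support hsupp
  have hcoe : hmem.toLp φ =ᵐ[μ] φ := hmem.coeFn_toLp
  refine ⟨hmem.toLp φ, ?_, tendsto_integralOp_self (B := B.toNNReal) hk hS hM ?_ ?_ ?_⟩
  · rw [Lp.dist_def, eLpNorm_congr_ae ((EventuallyEq.refl _ _).sub hcoe)]
    exact (ENNReal.toReal_le_of_le_ofReal (by positivity) hle).trans_lt (half_lt_self hδ)
  · exact (hcont.integrable_of_hasCompactSupport hsupp).congr hcoe.symm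
  · filter_upwards [hcoe] with x hx
    rw [hx]
    exact (hB x).trans (Real.le_coe_toNNReal B)
  · filter_upwards [hcoe] with x hx
    rw [hx]
    refine (hlim φ hcont hsupp x).congr fun i => integral_congr_ae ?_
    filter_upwards [hcoe] with y hy
    rw [hy]

end SchurTest

section Hyperbolic

variable {s : ℝ}

theorem csch_pos (hs : 0 < s) : 0 < csch s :=
  one_div_pos.2 (Real.sinh_pos_iff.2 hs)

theorem coth_sq_sub_csch_sq (hs : s ≠ 0) : coth s ^ 2 - csch s ^ 2 = 1 := by
  have hsinh : Real.sinh s ≠ 0 := Real.sinh_ne_zero.2 hs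
  rw [coth, csch, div_pow, div_pow, ← sub_div, Real.cosh_sq,
    div_eq_one_iff_eq (pow_ne_zero 2 hsinh)]
  ring

theorem hasDerivAt_csch (hs : s ≠ 0) : HasDerivAt csch (-(csch s * coth s)) s := by
  have hsinh : Real.sinh s ≠ 0 := Real.sinh_ne_zero.2 hs
  refine ((hasDerivAt_const s 1).div (Real.hasDerivAt_sinh s) hsinh).congr_deriv ?_
  rw [coth, csch]
  field_simp
  ring

theorem hasDerivAt_coth (hs : s ≠ 0) : HasDerivAt coth (-(csch s ^ 2)) s := by
  have hsinh : Real.sinh s ≠ 0 := Real.sinh_ne_zero.2 hs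
  refine ((Real.hasDerivAt_cosh s).div (Real.hasDerivAt_sinh s) hsinh).congr_deriv ?_
  rw [csch, div_pow, one_pow, ← neg_div]
  congr 1
  linarith [Real.cosh_sq s]

theorem tanh_eq_coth_sub_csch (s : ℝ) : Real.tanh s = coth (2 * s) - csch (2 * s) := by
  rcases eq_or_ne s 0 with rfl | hs
  · simp [coth, csch]
  have hcosh : Real.cosh s ≠ 0 := (Real.cosh_pos s).ne'
  rw [Real.tanh_eq_sinh_div_cosh, coth, csch, ← sub_div, Real.sinh_two_mul, Real.cosh_two_mul,
    Real.cosh_sq]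
  field_simp
  ring

theorem tanh_pos (hs : 0 < s) : 0 < Real.tanh s := by
  rw [Real.tanh_eq_sinh_div_cosh]
  exact div_pos (Real.sinh_pos_iff.2 hs) (Real.cosh_pos s)

theorem continuous_tanh : Continuous Real.tanh := by
  simp_rw [funext Real.tanh_eq_sinh_div_cosh]
  exact Real.continuous_sinh.div Real.continuous_cosh fun s => (Real.cosh_pos s).ne'

end Hyperbolic

section Mehler

/-- Mehler's formula: the heat kernel of `-d²/dx² + c² (x + b)² + l`. -/
def mehler (c b l t x y : ℝ) : ℝ :=
  √(c * csch (2 * c * t) / (2 * Real.pi)) * Real.exp (-l * t)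
    * Real.exp (-(c / 2) * ((x - y) ^ 2 * csch (2 * c * t)
        + ((x + b) ^ 2 + (y + b) ^ 2) * Real.tanh (c * t)))

/-- The logarithmic derivative of `mehler` in `t`. -/
def mehlerRate (c b l t x y : ℝ) : ℝ :=
  -(c * coth (2 * c * t)) - l
    + c ^ 2 * csch (2 * c * t) ^ 2 * ((x + b) ^ 2 + (y + b) ^ 2)
    - 2 * c ^ 2 * (csch (2 * c * t) * coth (2 * c * t)) * ((x + b) * (y + b))

/-- The logarithmic derivative of `mehler` in `x`. -/
def mehlerSlope (c b t x y : ℝ) : ℝ :=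
  -c * ((x + b) * coth (2 * c * t) - (y + b) * csch (2 * c * t))

variable {c b l t : ℝ}

theorem mehler_nonneg (x y : ℝ) : 0 ≤ mehler c b l t x y := by
  unfold mehler; positivity

theorem mehler_symm (x y : ℝ) : mehler c b l t x y = mehler c b l t y x := by
  rw [mehler, mehler, add_comm ((x + b) ^ 2), ← neg_sub y x, neg_sq]

theorem continuous_mehler : Continuous (Function.uncurry (mehler c b l t)) := by
  unfold mehler Function.uncurry; fun_prop

theorem continuous_mehlerRate : Continuous (Function.uncurry (mehlerRate c b l t)) := by
  unfold mehlerRate Function.uncurry; fun_prop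

theorem continuous_mehlerSlope : Continuous (Function.uncurry (mehlerSlope c b t)) := by
  unfold mehlerSlope Function.uncurry; fun_prop

theorem contDiff_mehler (y : ℝ) : ContDiff ℝ ∞ fun x => mehler c b l t x y := by
  unfold mehler; fun_prop

theorem contDiff_mehlerSlope_mul (y : ℝ) :
    ContDiff ℝ ∞ fun x => mehlerSlope c b t x y * mehler c b l t x y := by
  unfold mehlerSlope mehler; fun_prop

theorem hasDerivAt_csch_two_mul (hc : 0 < c) (ht : 0 < t) :
    HasDerivAt (fun t => csch (2 * c * t)) (-(2 * c * (csch (2 * c * t) * coth (2 * c * t)))) t :=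
  ((hasDerivAt_csch (by positivity)).comp t (hasDerivAt_const_mul (2 * c))).congr_deriv (by ring)

theorem hasDerivAt_coth_two_mul (hc : 0 < c) (ht : 0 < t) :
    HasDerivAt (fun t => coth (2 * c * t)) (-(2 * c * csch (2 * c * t) ^ 2)) t :=
  ((hasDerivAt_coth (by positivity)).comp t (hasDerivAt_const_mul (2 * c))).congr_deriv (by ring)

theorem hasDerivAt_sqrt_csch_two_mul (hc : 0 < c) (ht : 0 < t) :
    HasDerivAt (fun t => √(c * csch (2 * c * t) / (2 * Real.pi)))
      (-(c * coth (2 * c * t)) * √(c * csch (2 * c * t) / (2 * Real.pi))) t := by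
  have hcsch : 0 < csch (2 * c * t) := csch_pos (by positivity)
  have hpos : 0 < c * csch (2 * c * t) / (2 * Real.pi) := by positivity
  refine ((((hasDerivAt_csch_two_mul hc ht).const_mul c).div_const (2 * Real.pi)).sqrt
    hpos.ne').congr_deriv ?_
  rw [div_eq_iff (by positivity)]
  linear_combination 2 * c * coth (2 * c * t) * Real.mul_self_sqrt hpos.le

theorem hasDerivAt_mehler_time (hc : 0 < c) (ht : 0 < t) (x y : ℝ) :
    HasDerivAt (fun t => mehler c b l t x y) (mehlerRate c b l t x y * mehler c b l t x y) t := by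
  have hcsch := hasDerivAt_csch_two_mul hc ht
  have htanh : HasDerivAt (fun t => Real.tanh (c * t))
      (2 * c * (csch (2 * c * t) * coth (2 * c * t)) - 2 * c * csch (2 * c * t) ^ 2) t := by
    simp_rw [tanh_eq_coth_sub_csch, ← mul_assoc]
    refine ((hasDerivAt_coth_two_mul hc ht).sub hcsch).congr_deriv ?_
    ring
  have hexponent := ((hcsch.const_mul ((x - y) ^ 2)).add
    (htanh.const_mul ((x + b) ^ 2 + (y + b) ^ 2))).const_mul (-(c / 2))
  refine (((hasDerivAt_sqrt_csch_two_mul hc ht).mul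
    (hasDerivAt_const_mul (-l)).exp).mul hexponent.exp).congr_deriv ?_
  simp only [mehlerRate, mehler, Pi.mul_apply, Pi.add_apply]
  ring

theorem hasDerivAt_mehlerSlope (x y : ℝ) :
    HasDerivAt (fun x => mehlerSlope c b t x y) (-(c * coth (2 * c * t))) x := by
  refine (((((hasDerivAt_id x).add_const b).mul_const (coth (2 * c * t))).sub_const
    ((y + b) * csch (2 * c * t))).const_mul (-c)).congr_deriv ?_
  ring

theorem hasDerivAt_mehler_space (x y : ℝ) :
    HasDerivAt (fun x => mehler c b l t x y) (mehlerSlope c b t x y * mehler c b l t x y) x := by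
  have hx := hasDerivAt_id x
  have hexponent := (((((hx.sub_const y).pow 2).mul_const (csch (2 * c * t))).add
    ((((hx.add_const b).pow 2).add_const ((y + b) ^ 2)).mul_const (Real.tanh (c * t)))).const_mul
      (-(c / 2)))
  refine (hexponent.exp.const_mul _).congr_deriv ?_
  simp only [mehlerSlope, mehler, tanh_eq_coth_sub_csch, Pi.add_apply, Pi.pow_apply, id_eq,
    ← mul_assoc]
  ring

theorem hasDerivAt_mehlerSlope_mul (x y : ℝ) :
    HasDerivAt (fun x => mehlerSlope c b t x y * mehler c b l t x y)
      ((mehlerSlope c b t x y ^ 2 - c * coth (2 * c * t)) * mehler c b l t x y) x :=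
  ((hasDerivAt_mehlerSlope x y).mul (hasDerivAt_mehler_space x y)).congr_deriv (by ring)

theorem mehlerSlope_sq_sub (hc : 0 < c) (ht : 0 < t) (x y : ℝ) :
    mehlerSlope c b t x y ^ 2 - c * coth (2 * c * t)
      = mehlerRate c b l t x y + (c ^ 2 * (x + b) ^ 2 + l) := by
  have hid : coth (2 * c * t) ^ 2 - csch (2 * c * t) ^ 2 = 1 :=
    coth_sq_sub_csch_sq (by positivity)
  rw [mehlerSlope, mehlerRate]
  linear_combination c ^ 2 * (x + b) ^ 2 * hid

end Mehler

section MehlerBounds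

variable {c b l t : ℝ}

theorem memLp_exp_neg_mul_sq {κ : ℝ} (hκ : 0 < κ) (b : ℝ) :
    MemLp (fun x => Real.exp (-κ * (x + b) ^ 2)) 2 := by
  refine (memLp_two_iff_integrable_sq
    (Continuous.aestronglyMeasurable (by fun_prop))).2 ?_
  have h2κ : 0 < 2 * κ := by positivity
  refine ((integrable_exp_neg_mul_sq h2κ).comp_add_right b).congr (.of_forall fun x => ?_)
  simp only [← Real.exp_nat_mul]
  congr 1
  push_cast
  ring

theorem one_add_mul_exp_le {κ r : ℝ} (hκ : 0 < κ) (hr : 0 ≤ r) :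
    (1 + r) * Real.exp (-(2 * κ) * r) ≤ (1 + κ⁻¹) * Real.exp (-κ * r) := by
  have hpoly : 1 + r ≤ (1 + κ⁻¹) * Real.exp (κ * r) := by
    calc 1 + r ≤ 1 + r + (κ * r + κ⁻¹) := le_add_of_nonneg_right (by positivity)
      _ = (1 + κ⁻¹) * (κ * r + 1) := by field_simp; ring
      _ ≤ (1 + κ⁻¹) * Real.exp (κ * r) := by gcongr; exact Real.add_one_le_exp _
  calc (1 + r) * Real.exp (-(2 * κ) * r)
      ≤ (1 + κ⁻¹) * Real.exp (κ * r) * Real.exp (-(2 * κ) * r) := by gcongr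
    _ = (1 + κ⁻¹) * Real.exp (-κ * r) := by
        rw [mul_assoc, ← Real.exp_add]
        ring_nf

theorem exists_mehler_le_exp {t₁ t₂ : ℝ} (hc : 0 < c) (ht₁ : 0 < t₁) (h : t₁ ≤ t₂) (b l : ℝ) :
    ∃ κ > 0, ∃ A ≥ 0, ∀ t ∈ Set.Icc t₁ t₂, ∀ x y,
      mehler c b l t x y ≤ A * Real.exp (-(2 * κ) * ((x + b) ^ 2 + (y + b) ^ 2)) := by
  have hpos : ∀ t ∈ Set.Icc t₁ t₂, 0 < t := fun t ht => ht₁.trans_le ht.1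
  have htanh : ContinuousOn (fun t => Real.tanh (c * t)) (Set.Icc t₁ t₂) :=
    (continuous_tanh.comp (continuous_const_mul c)).continuousOn
  obtain ⟨t₀, ht₀, hmin⟩ := isCompact_Icc.exists_isMinOn (Set.nonempty_Icc.2 h) htanh
  have hfactor : ContinuousOn
      (fun t => √(c * csch (2 * c * t) / (2 * Real.pi)) * Real.exp (-l * t)) (Set.Icc t₁ t₂) :=
    ContinuousOn.mul (fun t ht =>
      (hasDerivAt_sqrt_csch_two_mul hc (hpos t ht)).continuousAt.continuousWithinAt) (by fun_prop)
  obtain ⟨A, hA⟩ := isCompact_Icc.exists_bound_of_continuousOn hfactor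
  have htanh₀ : 0 < Real.tanh (c * t₀) := tanh_pos (mul_pos hc (hpos t₀ ht₀))
  refine ⟨c * Real.tanh (c * t₀) / 4, by positivity, A,
    (norm_nonneg _).trans (hA t₀ ht₀), fun t ht x y => ?_⟩
  refine mul_le_mul ((le_abs_self _).trans (hA t ht)) (Real.exp_le_exp.2 ?_) (Real.exp_pos _).le
    ((norm_nonneg _).trans (hA t₀ ht₀))
  have hcsch := csch_pos (mul_pos (mul_pos two_pos hc) (hpos t ht))
  calc -(c / 2) * ((x - y) ^ 2 * csch (2 * c * t)
        + ((x + b) ^ 2 + (y + b) ^ 2) * Real.tanh (c * t))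
      ≤ -(c / 2) * (0 + ((x + b) ^ 2 + (y + b) ^ 2) * Real.tanh (c * t₀)) := by
        rw [neg_mul, neg_mul, neg_le_neg_iff]
        gcongr
        · positivity
        · exact hmin ht
    _ = -(2 * (c * Real.tanh (c * t₀) / 4)) * ((x + b) ^ 2 + (y + b) ^ 2) := by ring

theorem exists_memLp_weight_mul_mehler_le {t₁ t₂ : ℝ} (hc : 0 < c) (ht₁ : 0 < t₁) (h : t₁ ≤ t₂)
    (b l : ℝ) :
    ∃ G : ℝ × ℝ → ℝ, MemLp G 2 ∧ ∀ t ∈ Set.Icc t₁ t₂, ∀ x y,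
      (1 + ((x + b) ^ 2 + (y + b) ^ 2)) * mehler c b l t x y ≤ G (x, y) := by
  obtain ⟨κ, hκ, A, hA, hle⟩ := exists_mehler_le_exp hc ht₁ h b l
  refine ⟨fun z => A * (1 + κ⁻¹) * (‖Real.exp (-κ * (z.1 + b) ^ 2)‖
    * ‖Real.exp (-κ * (z.2 + b) ^ 2)‖), (memLp_two_mul_prod (memLp_exp_neg_mul_sq hκ b)
      (memLp_exp_neg_mul_sq hκ b)).const_mul _, fun t ht x y => ?_⟩
  set r := (x + b) ^ 2 + (y + b) ^ 2 with hr
  calc (1 + r) * mehler c b l t x y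
      ≤ (1 + r) * (A * Real.exp (-(2 * κ) * r)) := by gcongr; exact hle t ht x y
    _ = A * ((1 + r) * Real.exp (-(2 * κ) * r)) := by ring
    _ ≤ A * ((1 + κ⁻¹) * Real.exp (-κ * r)) :=
        mul_le_mul_of_nonneg_left (one_add_mul_exp_le hκ (by positivity)) hA
    _ = A * (1 + κ⁻¹) * (‖Real.exp (-κ * (x + b) ^ 2)‖ * ‖Real.exp (-κ * (y + b) ^ 2)‖) := by
        rw [Real.norm_of_nonneg (Real.exp_pos _).le, Real.norm_of_nonneg (Real.exp_pos _).le,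
          ← Real.exp_add, ← mul_add, ← hr, mul_assoc]

theorem isHilbertSchmidt_mul_mehler (hc : 0 < c) (ht : 0 < t) {P : ℝ → ℝ → ℝ} {B : ℝ}
    (hP : Continuous (Function.uncurry P))
    (hB : ∀ x y, |P x y| ≤ B * (1 + ((x + b) ^ 2 + (y + b) ^ 2))) :
    IsHilbertSchmidt (fun x y => P x y * mehler c b l t x y) volume := by
  obtain ⟨G, hG, hle⟩ := exists_memLp_weight_mul_mehler_le hc ht le_rfl b l
  have hB₀ : 0 ≤ B := nonneg_of_mul_nonneg_left ((abs_nonneg _).trans (hB 0 0)) (by positivity)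
  refine hG.of_le_mul (c := B) (hP.mul continuous_mehler).aestronglyMeasurable
    (.of_forall fun z => ?_)
  calc ‖P z.1 z.2 * mehler c b l t z.1 z.2‖
      ≤ B * (1 + ((z.1 + b) ^ 2 + (z.2 + b) ^ 2)) * mehler c b l t z.1 z.2 := by
        rw [norm_mul, Real.norm_of_nonneg (mehler_nonneg _ _)]
        exact mul_le_mul_of_nonneg_right (hB _ _) (mehler_nonneg _ _)
    _ ≤ B * ‖G z‖ := by
        rw [mul_assoc]
        gcongr
        exact (hle t ⟨le_rfl, le_rfl⟩ _ _).trans (le_abs_self _)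

theorem isHilbertSchmidt_mehler (hc : 0 < c) (ht : 0 < t) :
    IsHilbertSchmidt (mehler c b l t) volume := by
  have hone : ∀ x y : ℝ, |(1 : ℝ)| ≤ 1 * (1 + ((x + b) ^ 2 + (y + b) ^ 2)) := fun x y => by
    rw [abs_one, one_mul]
    exact le_add_of_nonneg_right (by positivity)
  simpa only [one_mul] using
    isHilbertSchmidt_mul_mehler (P := fun _ _ => 1) (l := l) hc ht continuous_const hone

theorem abs_mehlerRate_le (x y : ℝ) :
    |mehlerRate c b l t x y| ≤ (|c * coth (2 * c * t) + l| + c ^ 2 * csch (2 * c * t) ^ 2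
        + |c ^ 2 * (csch (2 * c * t) * coth (2 * c * t))|)
      * (1 + ((x + b) ^ 2 + (y + b) ^ 2)) := by
  have hmn : |2 * ((x + b) * (y + b))| ≤ (x + b) ^ 2 + (y + b) ^ 2 := by
    rw [abs_le]
    constructor <;> linarith [sq_nonneg (x + b + (y + b)), sq_nonneg (x + b - (y + b))]
  set r := (x + b) ^ 2 + (y + b) ^ 2 with hr
  have hr₀ : 0 ≤ r := by positivity
  calc |mehlerRate c b l t x y|
      = |-(c * coth (2 * c * t) + l) + c ^ 2 * csch (2 * c * t) ^ 2 * r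
        - c ^ 2 * (csch (2 * c * t) * coth (2 * c * t)) * (2 * ((x + b) * (y + b)))| := by
        rw [mehlerRate, ← hr]
        congr 1
        ring
    _ ≤ |c * coth (2 * c * t) + l| + c ^ 2 * csch (2 * c * t) ^ 2 * r
        + |c ^ 2 * (csch (2 * c * t) * coth (2 * c * t))| * r := by
        refine (abs_sub _ _).trans (add_le_add ((abs_add_le _ _).trans_eq ?_) ?_)
        · rw [abs_neg, abs_of_nonneg (a := _ * r) (by positivity)]
        · rw [abs_mul]
          gcongr
    _ ≤ _ := by
        rw [add_mul, add_mul]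
        gcongr
        · exact le_mul_of_one_le_right (abs_nonneg _) (le_add_of_nonneg_right hr₀)
        · exact le_add_of_nonneg_left zero_le_one
        · exact le_add_of_nonneg_left zero_le_one

theorem exists_abs_mehlerRate_le {t₁ t₂ : ℝ} (hc : 0 < c) (ht₁ : 0 < t₁) (b l : ℝ) :
    ∃ B, ∀ t ∈ Set.Icc t₁ t₂, ∀ x y,
      |mehlerRate c b l t x y| ≤ B * (1 + ((x + b) ^ 2 + (y + b) ^ 2)) := by
  have hpos : ∀ t ∈ Set.Icc t₁ t₂, 0 < t := fun t ht => ht₁.trans_le ht.1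
  have hcsch : ContinuousOn (fun t => csch (2 * c * t)) (Set.Icc t₁ t₂) := fun t ht =>
    (hasDerivAt_csch_two_mul hc (hpos t ht)).continuousAt.continuousWithinAt
  have hcoth : ContinuousOn (fun t => coth (2 * c * t)) (Set.Icc t₁ t₂) := fun t ht =>
    (hasDerivAt_coth_two_mul hc (hpos t ht)).continuousAt.continuousWithinAt
  have hbound : ContinuousOn (fun t => |c * coth (2 * c * t) + l| + c ^ 2 * csch (2 * c * t) ^ 2
      + |c ^ 2 * (csch (2 * c * t) * coth (2 * c * t))|) (Set.Icc t₁ t₂) := by fun_prop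
  obtain ⟨B, hB⟩ := isCompact_Icc.exists_bound_of_continuousOn hbound
  refine ⟨B, fun t ht x y => (abs_mehlerRate_le x y).trans ?_⟩
  gcongr
  exact (le_abs_self _).trans (hB t ht)

theorem isHilbertSchmidt_mehlerRate_mul (hc : 0 < c) (ht : 0 < t) :
    IsHilbertSchmidt (fun x y => mehlerRate c b l t x y * mehler c b l t x y) volume :=
  isHilbertSchmidt_mul_mehler hc ht continuous_mehlerRate abs_mehlerRate_le

theorem isHilbertSchmidt_potential_mul_mehler (hc : 0 < c) (ht : 0 < t) :
    IsHilbertSchmidt (fun x y => (c ^ 2 * (x + b) ^ 2 + l) * mehler c b l t x y) volume := by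
  refine isHilbertSchmidt_mul_mehler (B := c ^ 2 + |l|) hc ht
    (by unfold Function.uncurry; fun_prop) fun x y => ?_
  refine (abs_add_le _ _).trans ?_
  rw [abs_of_nonneg (by positivity), add_mul]
  gcongr
  · linarith [sq_nonneg (y + b)]
  · exact le_mul_of_one_le_right (abs_nonneg _) (le_add_of_nonneg_right (by positivity))

theorem isHilbertSchmidt_mehlerSlope_mul (hc : 0 < c) (ht : 0 < t) :
    IsHilbertSchmidt (fun x y => mehlerSlope c b t x y * mehler c b l t x y) volume := by
  refine isHilbertSchmidt_mul_mehler (B := c * (|coth (2 * c * t)| + |csch (2 * c * t)|)) hc ht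
    continuous_mehlerSlope fun x y => ?_
  have habs_le : ∀ m : ℝ, |m| ≤ 1 + m ^ 2 := fun m => by
    rw [← sq_abs]
    linarith [sq_nonneg (|m| - 1 / 2)]
  calc |mehlerSlope c b t x y|
      = c * |(x + b) * coth (2 * c * t) - (y + b) * csch (2 * c * t)| := by
        rw [mehlerSlope, abs_mul, abs_neg, abs_of_pos hc]
    _ ≤ c * (|x + b| * |coth (2 * c * t)| + |y + b| * |csch (2 * c * t)|) := by
        gcongr
        exact (abs_sub _ _).trans_eq (by rw [abs_mul, abs_mul])
    _ ≤ c * ((1 + ((x + b) ^ 2 + (y + b) ^ 2)) * |coth (2 * c * t)|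
        + (1 + ((x + b) ^ 2 + (y + b) ^ 2)) * |csch (2 * c * t)|) := by
        gcongr
        · linarith [habs_le (x + b), sq_nonneg (y + b)]
        · linarith [habs_le (y + b), sq_nonneg (x + b)]
    _ = c * (|coth (2 * c * t)| + |csch (2 * c * t)|) * (1 + ((x + b) ^ 2 + (y + b) ^ 2)) := by
        ring

variable {𝕜 : Type*} [RCLike 𝕜]

theorem hasDerivAt_integralOp_mehler (hc : 0 < c) (ht : 0 < t) (f : L2 𝕜) :
    HasDerivAt (fun t => integralOp (mehler c b l t) f)
      (integralOp (fun x y => mehlerRate c b l t x y * mehler c b l t x y) f) t := by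
  have hpos : ∀ s ∈ Set.Ioo (t / 2) (2 * t), 0 < s := fun s hs => (half_pos ht).trans hs.1
  obtain ⟨G, hG, hle⟩ := exists_memLp_weight_mul_mehler_le (t₂ := 2 * t) hc (half_pos ht)
    (by linarith) b l
  obtain ⟨B, hB⟩ := exists_abs_mehlerRate_le (t₂ := 2 * t) hc (half_pos ht) b l
  refine hasDerivAt_integralOp (a := t / 2) (b := 2 * t) (G := fun z => |B| * G z)
    (k' := fun t x y => mehlerRate c b l t x y * mehler c b l t x y) ⟨by linarith, by linarith⟩
    (hG.const_mul |B|) (fun s hs => isHilbertSchmidt_mehler hc (hpos s hs))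
    (isHilbertSchmidt_mehlerRate_mul hc ht)
    (fun s hs => hasDerivAt_mehler_time hc (hpos s hs)) (fun s hs x y => ?_) f
  rw [norm_mul, Real.norm_of_nonneg (mehler_nonneg x y)]
  calc |mehlerRate c b l s x y| * mehler c b l s x y
      ≤ |B| * (1 + ((x + b) ^ 2 + (y + b) ^ 2)) * mehler c b l s x y := by
        refine mul_le_mul_of_nonneg_right ((hB s ⟨hs.1.le, hs.2.le⟩ x y).trans ?_)
          (mehler_nonneg x y)
        gcongr
        exact le_abs_self B
    _ ≤ |B| * G (x, y) := by
        rw [mul_assoc]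
        gcongr
        exact hle s ⟨hs.1.le, hs.2.le⟩ x y

theorem operatorGraph_integralOp_mehler (hc : 0 < c) (ht : 0 < t) (f : L2 𝕜) :
    OperatorGraph (fun x => c ^ 2 * (x + b) ^ 2 + l) (integralOp (mehler c b l t) f)
      (-integralOp (fun x y => mehlerRate c b l t x y * mehler c b l t x y) f) := by
  have hsecond : ∀ y x, HasDerivAt (fun x => mehlerSlope c b t x y * mehler c b l t x y)
      (mehlerRate c b l t x y * mehler c b l t x y
        + (c ^ 2 * (x + b) ^ 2 + l) * mehler c b l t x y) x := fun y x => by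
    rw [← add_mul, ← mehlerSlope_sq_sub hc ht]
    exact hasDerivAt_mehlerSlope_mul x y
  have hpot := isHilbertSchmidt_potential_mul_mehler (b := b) (l := l) hc ht
  have hsum : IsHilbertSchmidt (fun x y => mehlerRate c b l t x y * mehler c b l t x y
      + (c ^ 2 * (x + b) ^ 2 + l) * mehler c b l t x y) volume :=
    MemLp.add (isHilbertSchmidt_mehlerRate_mul hc ht) hpot
  have hgraph := (isHilbertSchmidt_mehler hc ht).operatorGraph
    (V := fun x => c ^ 2 * (x + b) ^ 2 + l) (Continuous.aestronglyMeasurable (by fun_prop))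
    (isHilbertSchmidt_mehlerSlope_mul hc ht) hsum hpot contDiff_mehler
    contDiff_mehlerSlope_mul (fun y x => hasDerivAt_mehler_space x y) hsecond f
  simpa only [add_sub_cancel_right] using hgraph

end MehlerBounds

section InitialCondition

open ProbabilityTheory
open scoped NNReal ENNReal

theorem gaussianReal_eq_map (x : ℝ) (v : ℝ≥0) :
    gaussianReal x v = (gaussianReal 0 1).map fun w => x + √v * w := by
  have hcomp : (fun w => x + √v * w) = (x + ·) ∘ (√v * ·) := rfl
  rw [hcomp, ← Measure.map_map (measurable_const_add x) (measurable_const_mul _),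
    gaussianReal_map_const_mul, gaussianReal_map_const_add, mul_zero, zero_add, mul_one]
  congr 1
  ext
  exact (Real.sq_sqrt v.coe_nonneg).symm

theorem tendsto_integral_gaussianReal {ι E : Type*} [NormedAddCommGroup E] [NormedSpace ℝ E]
    [CompleteSpace E] {L : Filter ι} [L.IsCountablyGenerated] {v : ι → ℝ≥0} {g : ι → ℝ → E}
    {x B : ℝ} {e : E} (hv : Tendsto v L (𝓝 0)) (hg : ∀ᶠ i in L, Continuous (g i))
    (hB : ∀ᶠ i in L, ∀ y, ‖g i y‖ ≤ B) (hlim : Tendsto (Function.uncurry g) (L ×ˢ 𝓝 x) (𝓝 e)) :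
    Tendsto (fun i => ∫ y, g i y ∂gaussianReal x (v i)) L (𝓝 e) := by
  have hmap : ∀ᶠ i in L, ∫ w, g i (x + √(v i) * w) ∂gaussianReal 0 1
      = ∫ y, g i y ∂gaussianReal x (v i) := by
    filter_upwards [hg] with i hi
    rw [gaussianReal_eq_map x, integral_map (by fun_prop) hi.aestronglyMeasurable]
  refine Tendsto.congr' hmap ?_
  rw [← show ∫ _, e ∂gaussianReal 0 1 = e by rw [integral_const, probReal_univ, one_smul]]
  refine tendsto_integral_filter_of_dominated_convergence (fun _ => B) ?_
    (hB.mono fun i hi => .of_forall fun w => hi _) (integrable_const B) (.of_forall fun w => ?_)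
  · filter_upwards [hg] with i hi
    exact (hi.comp (by fun_prop)).aestronglyMeasurable
  · refine hlim.comp (tendsto_id.prodMk ?_)
    have hsqrt : Tendsto (fun i => √(v i)) L (𝓝 0) := by
      simpa using (NNReal.tendsto_coe.2 hv).sqrt
    simpa using (hsqrt.mul_const w).const_add x

variable {c b l t : ℝ}

/-- The variance of the Gaussian factor of `mehler`. -/
def mehlerVariance (c t : ℝ) : ℝ≥0 := (Real.sinh (2 * c * t) / c).toNNReal

theorem mehlerVariance_ne_zero (hc : 0 < c) (ht : 0 < t) : mehlerVariance c t ≠ 0 :=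
  (Real.toNNReal_pos.2 (div_pos (Real.sinh_pos_iff.2 (by positivity)) hc)).ne'

theorem tendsto_mehlerVariance (c : ℝ) : Tendsto (mehlerVariance c) (𝓝 0) (𝓝 0) := by
  have hcont : Continuous (mehlerVariance c) := by unfold mehlerVariance; fun_prop
  simpa [mehlerVariance] using hcont.tendsto 0

theorem mehler_eq_mul_gaussianPDFReal (hc : 0 < c) (ht : 0 < t) (x y : ℝ) :
    mehler c b l t x y = Real.exp (-l * t)
      * Real.exp (-(c / 2) * ((x + b) ^ 2 + (y + b) ^ 2) * Real.tanh (c * t))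
      * gaussianPDFReal x (mehlerVariance c t) y := by
  have hsinh : 0 < Real.sinh (2 * c * t) := Real.sinh_pos_iff.2 (by positivity)
  have hv : (mehlerVariance c t : ℝ) = Real.sinh (2 * c * t) / c :=
    Real.coe_toNNReal _ (div_pos hsinh hc).le
  have hfactor : √(c * csch (2 * c * t) / (2 * Real.pi))
      = (√(2 * Real.pi * (Real.sinh (2 * c * t) / c)))⁻¹ := by
    rw [← Real.sqrt_inv, csch]
    congr 1
    field_simp
  have hexponent : -(c / 2) * ((x - y) ^ 2 * csch (2 * c * t))
      = -(y - x) ^ 2 / (2 * (Real.sinh (2 * c * t) / c)) := by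
    rw [csch]
    field_simp
    ring
  rw [mehler, gaussianPDFReal, hv, hfactor, mul_add, Real.exp_add, hexponent]
  ring_nf

theorem isSchurBounded_mehler (hc : 0 < c) (ht : 0 < t) :
    IsSchurBounded (mehler c b l t) volume (Real.exp (-l * t)).toNNReal := by
  have hrow : ∀ x, ∫⁻ y, ‖mehler c b l t x y‖ₑ ≤ (Real.exp (-l * t)).toNNReal := fun x => by
    calc ∫⁻ y, ‖mehler c b l t x y‖ₑ
        ≤ ∫⁻ y, ENNReal.ofReal (Real.exp (-l * t))
            * ENNReal.ofReal (gaussianPDFReal x (mehlerVariance c t) y) := by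
          refine lintegral_mono fun y => ?_
          rw [Real.enorm_of_nonneg (mehler_nonneg x y), mehler_eq_mul_gaussianPDFReal hc ht,
            ← ENNReal.ofReal_mul (Real.exp_pos _).le]
          refine ENNReal.ofReal_le_ofReal (mul_le_mul_of_nonneg_right ?_
            (gaussianPDFReal_nonneg _ _ _))
          refine mul_le_of_le_one_right (Real.exp_pos _).le (Real.exp_le_one_iff.2 ?_)
          have htanh := tanh_pos (mul_pos hc ht)
          rw [neg_mul, neg_mul, neg_nonpos]
          positivity
      _ = (Real.exp (-l * t)).toNNReal := by
          rw [lintegral_const_mul _ (by fun_prop),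
            lintegral_gaussianPDFReal_eq_one x (mehlerVariance_ne_zero hc ht), mul_one]
          rfl
  exact ⟨hrow, fun y => by simpa only [mehler_symm _ y] using hrow y⟩

variable {𝕜 : Type*} [RCLike 𝕜]

theorem integral_mehler_smul (hc : 0 < c) (ht : 0 < t) (x : ℝ) (φ : ℝ → 𝕜) :
    ∫ y, mehler c b l t x y • φ y = Real.exp (-l * t) •
      ∫ y, Real.exp (-(c / 2) * ((x + b) ^ 2 + (y + b) ^ 2) * Real.tanh (c * t)) • φ y
        ∂gaussianReal x (mehlerVariance c t) := by
  rw [integral_gaussianReal_eq_integral_smul (mehlerVariance_ne_zero hc ht), ← integral_smul]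
  refine integral_congr_ae (.of_forall fun y => ?_)
  simp only [mehler_eq_mul_gaussianPDFReal hc ht, smul_smul]
  ring_nf

theorem tendsto_exp_neg_mul (l : ℝ) : Tendsto (fun t => Real.exp (-l * t)) (𝓝[>] 0) (𝓝 1) := by
  have hcont : Continuous fun t => Real.exp (-l * t) := by fun_prop
  simpa using (hcont.tendsto 0).mono_left nhdsWithin_le_nhds

theorem tendsto_integral_mehler_smul (hc : 0 < c) {φ : ℝ → 𝕜} (hφ : Continuous φ) {B : ℝ}
    (hB : ∀ y, ‖φ y‖ ≤ B) (x : ℝ) :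
    Tendsto (fun t => ∫ y, mehler c b l t x y • φ y) (𝓝[>] 0) (𝓝 (φ x)) := by
  have hcont : Continuous (Function.uncurry fun t y : ℝ =>
      Real.exp (-(c / 2) * ((x + b) ^ 2 + (y + b) ^ 2) * Real.tanh (c * t)) • φ y) := by
    have htanh := continuous_tanh
    unfold Function.uncurry
    fun_prop
  have hgauss : Tendsto (fun t => ∫ y, Real.exp (-(c / 2) * ((x + b) ^ 2 + (y + b) ^ 2)
      * Real.tanh (c * t)) • φ y ∂gaussianReal x (mehlerVariance c t)) (𝓝[>] 0) (𝓝 (φ x)) := by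
    refine tendsto_integral_gaussianReal (B := B)
      ((tendsto_mehlerVariance c).mono_left nhdsWithin_le_nhds)
      (.of_forall fun t => hcont.comp (Continuous.prodMk_right t)) ?_ ?_
    · filter_upwards [self_mem_nhdsWithin] with t ht y
      have htanh := tanh_pos (mul_pos hc ht)
      rw [norm_smul, Real.norm_of_nonneg (Real.exp_pos _).le]
      refine (mul_le_of_le_one_left (norm_nonneg _) (Real.exp_le_one_iff.2 ?_)).trans (hB y)
      rw [neg_mul, neg_mul, neg_nonpos]
      positivity
    · have hle : 𝓝[>] (0 : ℝ) ×ˢ 𝓝 x ≤ 𝓝 (0, x) := by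
        rw [nhds_prod_eq]
        exact prod_mono_left _ nhdsWithin_le_nhds
      simpa using (hcont.tendsto (0, x)).mono_left hle
  have hlim := (tendsto_exp_neg_mul l).smul hgauss
  rw [one_smul] at hlim
  refine hlim.congr' ?_
  filter_upwards [self_mem_nhdsWithin] with t ht
  exact (integral_mehler_smul hc ht x φ).symm

theorem tendsto_integralOp_mehler (hc : 0 < c) (f : L2 𝕜) :
    Tendsto (fun t => integralOp (mehler c b l t) f) (𝓝[>] 0) (𝓝 f) := by
  refine tendsto_integralOp_of_continuous (L := 𝓝[>] 0)
    (eventually_nhdsWithin_of_forall fun t ht => isHilbertSchmidt_mehler hc ht)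
    (eventually_nhdsWithin_of_forall fun t ht => isSchurBounded_mehler hc ht) ?_
    (fun φ hφ hsupp x => ?_) f
  · simpa only [Real.toNNReal_one] using tendsto_real_toNNReal (tendsto_exp_neg_mul l)
  · obtain ⟨B, hB⟩ := hsupp.exists_bound_of_continuous hφ
    exact tendsto_integral_mehler_smul hc hφ hB x

theorem isHeatSolution_integralOp_mehler (hc : 0 < c) (f : L2 𝕜) :
    IsHeatSolution (fun x => c ^ 2 * (x + b) ^ 2 + l) f
      (fun t => integralOp (mehler c b l t) f) where
  equation _ ht := ⟨_, operatorGraph_integralOp_mehler hc ht f, by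
    rw [neg_neg]; exact hasDerivAt_integralOp_mehler hc ht f⟩
  initial := tendsto_integralOp_mehler hc f

theorem isHeatKernel_mehler (hc : 0 < c) :
    IsHeatKernel 𝕜 (fun x => c ^ 2 * (x + b) ^ 2 + l) (fun x y t => mehler c b l t x y) where
  measurable _ _ := continuous_mehler.aestronglyMeasurable
  exists_solution f := ⟨_, isHeatSolution_integralOp_mehler hc f⟩
  representation f u hu t ht := by
    have hu_eq : u t = integralOp (mehler c b l t) f :=
      hu.unique (l := l) (Continuous.aestronglyMeasurable (by fun_prop))
        (.of_forall fun x => le_add_of_nonneg_left (by positivity))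
        (isHeatSolution_integralOp_mehler hc f) ht
    have hK := isHilbertSchmidt_mehler (b := b) (l := l) hc ht
    filter_upwards [hK.ae_integrable_smul f, hK.coeFn_integralOp f] with x hint hx
    exact ⟨hint, by rw [hu_eq, hx]⟩

end InitialCondition

section KernelUniqueness

theorem ae_prod_of_ae_ae {α β : Type*} [MeasurableSpace α] [MeasurableSpace β] {μ : Measure α}
    {ν : Measure β} [SFinite ν] {p : α × β → Prop} (hp : NullMeasurableSet {z | p z} (μ.prod ν))
    (h : ∀ᵐ x ∂μ, ∀ᵐ y ∂ν, p (x, y)) : ∀ᵐ z ∂μ.prod ν, p z := by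
  obtain ⟨s, hs, hps⟩ := hp
  have hmem : ∀ᵐ z ∂μ.prod ν, z ∈ s := by
    rw [Measure.ae_prod_mem_iff_ae_ae_mem hs]
    filter_upwards [h, Measure.ae_ae_of_ae_prod hps.mem_iff] with x hx hiff
    filter_upwards [hx, hiff] with y hy hiff_y using hiff_y.1 hy
  filter_upwards [hmem, hps.mem_iff] with z hz hiff using hiff.2 hz

theorem ae_eq_zero_of_forall_rat_setIntegral_eq_zero {E : Type*} [NormedAddCommGroup E]
    [NormedSpace ℝ E] [CompleteSpace E] {d : ℝ → E}
    (hint : ∀ q r : ℚ, IntegrableOn d (Set.Ioc (q : ℝ) r))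
    (hzero : ∀ q r : ℚ, ∫ x in Set.Ioc (q : ℝ) r, d x = 0) : ∀ᵐ x, d x = 0 := by
  have hloc : LocallyIntegrable d := fun x => by
    obtain ⟨q, hq⟩ := exists_rat_lt x
    obtain ⟨r, hr⟩ := exists_rat_gt x
    exact ⟨_, Ioc_mem_nhds hq hr, hint q r⟩
  have hprimitive : (fun x : ℝ => ∫ y in ((0 : ℚ) : ℝ)..x, d y) = fun _ => 0 := by
    refine Rat.isDenseEmbedding_coe_real.dense.equalizer
      (intervalIntegral.continuous_primitive (fun a b =>
        (hloc.integrableOn_isCompact isCompact_uIcc).intervalIntegrable) _)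
      continuous_const (funext fun q => ?_)
    simp only [Function.comp_apply, intervalIntegral, hzero, sub_self]
  filter_upwards [LocallyIntegrable.ae_hasDerivAt_integral hloc] with x hx
  have hderiv := hx ((0 : ℚ) : ℝ)
  rw [hprimitive] at hderiv
  exact hderiv.unique (hasDerivAt_const x 0)

variable {𝕜 : Type*} [RCLike 𝕜]

theorem ae_eq_zero_of_forall_ae_integral_smul_eq_zero {K : ℝ → ℝ → ℝ}
    (hK : AEStronglyMeasurable (Function.uncurry K))
    (h : ∀ f : L2 𝕜, ∀ᵐ x, Integrable (fun y => K x y • f y) ∧ ∫ y, K x y • f y = 0) :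
    Function.uncurry K =ᵐ[volume] 0 := by
  have hinterval : ∀ q r : ℚ, ∀ᵐ x, IntegrableOn (fun y => K x y • (1 : 𝕜)) (Set.Ioc (q : ℝ) r)
      ∧ ∫ y in Set.Ioc (q : ℝ) r, K x y • (1 : 𝕜) = 0 := fun q r => by
    obtain ⟨f, hf⟩ : ∃ f : L2 𝕜, f =ᵐ[volume] (Set.Ioc (q : ℝ) r).indicator fun _ => 1 :=
      ⟨indicatorConstLp 2 measurableSet_Ioc measure_Ioc_lt_top.ne 1, indicatorConstLp_coeFn⟩
    filter_upwards [h f] with x hx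
    have hind : (fun y => K x y • f y) =ᵐ[volume]
        (Set.Ioc (q : ℝ) r).indicator fun y => K x y • 1 := by
      filter_upwards [hf] with y hy
      rw [hy, Set.indicator_smul_apply]
    rwa [integrable_congr hind, integrable_indicator_iff measurableSet_Ioc,
      integral_congr_ae hind, integral_indicator measurableSet_Ioc] at hx
  refine ae_prod_of_ae_ae (nullMeasurableSet_eq_fun hK.aemeasurable aemeasurable_const) ?_
  filter_upwards [ae_all_iff.2 fun q => ae_all_iff.2 fun r => hinterval q r] with x hx
  filter_upwards [ae_eq_zero_of_forall_rat_setIntegral_eq_zero (fun q r => (hx q r).1)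
    fun q r => (hx q r).2] with y hy
  exact (smul_eq_zero.1 hy).resolve_right one_ne_zero

theorem IsHeatKernel.ae_eq {V : ℝ → ℝ} {p q : ℝ → ℝ → ℝ → ℝ} (hp : IsHeatKernel 𝕜 V p)
    (hq : IsHeatKernel 𝕜 V q) {t : ℝ} (ht : 0 < t) :
    ∀ᵐ z : ℝ × ℝ, p z.1 z.2 t = q z.1 z.2 t := by
  have hdiff := ae_eq_zero_of_forall_ae_integral_smul_eq_zero (𝕜 := 𝕜)
    (K := fun x y => p x y t - q x y t) ((hp.measurable t ht).sub (hq.measurable t ht))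
    fun f => by
      obtain ⟨u, hu⟩ := hp.exists_solution f
      filter_upwards [hp.representation f u hu t ht, hq.representation f u hu t ht]
        with x ⟨hpi, hpx⟩ ⟨hqi, hqx⟩
      simp_rw [sub_smul]
      exact ⟨hpi.sub hqi, by rw [integral_sub hpi hqi, ← hpx, ← hqx, sub_self]⟩
  filter_upwards [hdiff] with z hz using sub_eq_zero.1 hz

end KernelUniqueness

section QuadraticPotential

variable {a₀ a₁ a₂ : ℝ}

theorem quadraticPotential_eq (ha₂ : 0 < a₂) (x : ℝ) :
    a₂ * x ^ 2 + a₁ * x + a₀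
      = √a₂ ^ 2 * (x + a₁ / (2 * a₂)) ^ 2 + (a₀ - a₁ ^ 2 / (4 * a₂)) := by
  rw [Real.sq_sqrt ha₂.le]
  field_simp
  ring

theorem quadraticKernel_eq_mehler (ha₂ : 0 < a₂) (x y t : ℝ) :
    quadraticKernel a₀ a₁ a₂ x y t
      = mehler (√a₂) (a₁ / (2 * a₂)) (a₀ - a₁ ^ 2 / (4 * a₂)) t x y := by
  have hsqrt : 0 < √a₂ := Real.sqrt_pos.2 ha₂
  simp only [quadraticKernel, mehler, tanh_eq_coth_sub_csch, mul_assoc, ← Real.exp_add]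
  congr 2
  set c := √a₂
  have hca : a₂ = c ^ 2 := (Real.sq_sqrt ha₂.le).symm
  rw [hca]
  field_simp
  ring

theorem isHeatKernel_quadraticKernel (𝕜 : Type*) [RCLike 𝕜] (ha₂ : 0 < a₂) :
    IsHeatKernel 𝕜 (fun x => a₂ * x ^ 2 + a₁ * x + a₀)
      (fun x y t => quadraticKernel a₀ a₁ a₂ x y t) := by
  simp_rw [quadraticPotential_eq ha₂, quadraticKernel_eq_mehler ha₂]
  exact isHeatKernel_mehler (Real.sqrt_pos.2 ha₂)

theorem continuous_quadraticKernel (t : ℝ) :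
    Continuous fun z : ℝ × ℝ => quadraticKernel a₀ a₁ a₂ z.1 z.2 t := by
  unfold quadraticKernel
  fun_prop

end QuadraticPotential

end Schrodinger

end

theorem theorem2 (𝕜 : Type*) [RCLike 𝕜] (a₀ a₁ a₂ : ℝ) (ha₂ : 0 < a₂) :
    Schrodinger.IsHeatKernel 𝕜 (fun x => a₂ * x ^ 2 + a₁ * x + a₀)
        (fun x y t => Schrodinger.quadraticKernel a₀ a₁ a₂ x y t) ∧
      (∀ t : ℝ, 0 < t →
        Continuous (fun z : ℝ × ℝ => Schrodinger.quadraticKernel a₀ a₁ a₂ z.1 z.2 t)) ∧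
      ∀ p : ℝ → ℝ → ℝ → ℝ,
        Schrodinger.IsHeatKernel 𝕜 (fun x => a₂ * x ^ 2 + a₁ * x + a₀) p →
          ∀ t : ℝ, 0 < t →
            (∀ᵐ z : ℝ × ℝ, p z.1 z.2 t = Schrodinger.quadraticKernel a₀ a₁ a₂ z.1 z.2 t) ∧
            (Continuous (fun z : ℝ × ℝ => p z.1 z.2 t) →
              ∀ x y : ℝ, p x y t = Schrodinger.quadraticKernel a₀ a₁ a₂ x y t) := by
  have hker := Schrodinger.isHeatKernel_quadraticKernel (a₀ := a₀) (a₁ := a₁) 𝕜 ha₂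
  refine ⟨hker, fun t _ => Schrodinger.continuous_quadraticKernel t, fun p hp t ht => ?_⟩
  have hae := hp.ae_eq hker ht
  refine ⟨hae, fun hcont x y => ?_⟩
  exact congrFun ((hcont.ae_eq_iff_eq volume
    (Schrodinger.continuous_quadraticKernel t)).1 hae) (x, y)
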